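/- A real-algebraic curve of degree $d$ is the real zero locus $\Gamma$ of a squarefree polynomial $f\in\mathbb R[x,y]$ of degree $d$; it has no circle component if no polynomial $(x-x_0)^2+(y-y_0)^2-r^2$ with $x_0,y_0\in\mathbb R$, $r>0$ divides $f$. A (real) diameter of $\Gamma$ is a straight segment joining two distinct nonsingular points of $\Gamma$ and perpendicular to the tangent lines of $\Gamma$ at both endpoints. Let $\mathbb R\mathrm{Diam}(d)$ be the maximal (supremal) number of diameters among real-algebraic curves of degree $d$ that have no circle component and only finitely many diameters. **Proposition.** For every integer $d\ge 1$, $$\mathbb R\mathrm{Diam}(d)\ \ge\ \tfrac12 d^4-d^3+\tfrac12 d .$$ Moreover, the bound is realized by small resolutions of line arrangements with arbitrarily close slopes ("oblate" arrangements): for every $\delta>0$ there are $d$ lines $y=a_ix+b_i$ in $\mathbb R^2$, no two parallel, no two perpendicular and no three concurrent, with $|a_i-a_j|<\delta$ for all $i,j$, and a polynomial $H\in\mathbb R[x,y]$ of degree at most $d$, such that the following holds. Put $G=\prod_i (y-a_ix-b_i)$. At each intersection point $v$ of two of the lines, $H(v)$ is nonzero and has the sign that $G$ takes near $v$ on the two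 opposite obtuse sectors bounded by these lines (so, passing from $G$ to $G+\varepsilon H$ with small $\varepsilon>0$, the two obtuse sectors at $v$ are glued together while the two acute sectors stay separated). For all sufficiently small $\varepsilon>0$, the polynomial $G+\varepsilon H$ is squarefree of degree $d$, and the curve $G+\varepsilon H=0$ has no circle component, has no real singular points, and has finitely many diameters, at least $\tfrac12 d^4-d^3+\tfrac12 d$ in number. -/

import Mathlib

open scoped Topology

noncomputable section

namespace RealDiam

/-- Real polynomials in the two coordinates of the plane. -/
abbrev Poly := MvPolynomial (Fin 2) ℝ

/-- The points of the real plane. Only its topology and the standard dot product are used. -/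
abbrev Plane := Fin 2 → ℝ

/-- The real locus of the curve `f = 0`. -/
def zeroLocus (f : Poly) : Set Plane := {p | MvPolynomial.eval p f = 0}

/-- The gradient of `f` at `p`. -/
def grad (f : Poly) (p : Plane) : Plane :=
  fun i => MvPolynomial.eval p (MvPolynomial.pderiv i f)

/-- `p` is a nonsingular real point of the curve `f = 0`. -/
def IsNonsingularPoint (f : Poly) (p : Plane) : Prop :=
  p ∈ zeroLocus f ∧ grad f p ≠ 0

/-- `u` is perpendicular to the tangent line of `f = 0` at `p`, whose direction vectors are the `w`
with `grad f p ⬝ᵥ w = 0` (for `p` nonsingular). -/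
def PerpToTangent (f : Poly) (p u : Plane) : Prop :=
  ∀ w : Plane, grad f p ⬝ᵥ w = 0 → u ⬝ᵥ w = 0

/-- The (real) diameters of the curve `f = 0`: segments, given by their unordered pair of distinct
endpoints, that connect two nonsingular points of the curve and are perpendicular to the tangent
lines at both endpoints. -/
def diameters (f : Poly) : Set (Sym2 Plane) :=
  {s | ∃ p q : Plane, s = s(p, q) ∧ p ≠ q ∧
    IsNonsingularPoint f p ∧ IsNonsingularPoint f q ∧
    PerpToTangent f p (q - p) ∧ PerpToTangent f q (q - p)}

/-- The equation of the circle with centre `c` and radius `r`. -/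
def circlePoly (c : Plane) (r : ℝ) : Poly :=
  (MvPolynomial.X 0 - MvPolynomial.C (c 0)) ^ 2 +
    (MvPolynomial.X 1 - MvPolynomial.C (c 1)) ^ 2 - MvPolynomial.C (r ^ 2)

/-- `f` is a reduced equation of a real-algebraic curve of degree `d` without circles as
irreducible components. -/
structure IsCircleFreeCurve (d : ℕ) (f : Poly) : Prop where
  squarefree : Squarefree f
  degree_eq : f.totalDegree = d
  no_circle : ∀ (c : Plane) (r : ℝ), 0 < r → ¬ circlePoly c r ∣ f

/-- The maximal number of real diameters of real-algebraic curves of degree `d` having no circles as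
irreducible components, among those with finitely many diameters (two parallel lines have
infinitely many). -/
def RDiam (d : ℕ) : ℕ∞ :=
  ⨆ f ∈ {f : Poly | IsCircleFreeCurve d f ∧ (diameters f).Finite}, (diameters f).encard

/-- The affine form `y - a x - b`, whose zero locus is the line of slope `a` and intercept `b`. -/
def lineForm (a b : ℝ) : Poly :=
  MvPolynomial.X 1 - MvPolynomial.C a * MvPolynomial.X 0 - MvPolynomial.C b

/-- The product of the forms of the lines `y = a i x + b i`; its zero locus is the arrangement. -/
def arrangement {d : ℕ} (a b : Fin d → ℝ) : Poly := ∏ i, lineForm (a i) (b i)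

/-- No two lines are parallel, no two are perpendicular and no three are concurrent. -/
structure StronglyGeneric {d : ℕ} (a b : Fin d → ℝ) : Prop where
  not_parallel : ∀ i j, i ≠ j → a i ≠ a j
  not_perp : ∀ i j, i ≠ j → 1 + a i * a j ≠ 0
  not_concurrent : ∀ i j k, i ≠ j → i ≠ k → j ≠ k → ∀ p : Plane,
    p ∈ zeroLocus (lineForm (a i) (b i)) → p ∈ zeroLocus (lineForm (a j) (b j)) →
    p ∉ zeroLocus (lineForm (a k) (b k))

/-- The slopes of all lines are within `δ` of each other. -/
def OblateWithin {d : ℕ} (δ : ℝ) (a : Fin d → ℝ) : Prop := ∀ i j, |a i - a j| < δ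

/-- The wide cone of two non-perpendicular lines of slopes `a₁`, `a₂`: the pair of opposite obtuse
sectors of the complement. The sectors containing the directions of intermediate slope are those
where the product of the two forms is negative, and they are acute exactly when the direction
vectors `(1, a₁)` and `(1, a₂)` have positive dot product `1 + a₁ a₂`. -/
def wideCone (a₁ b₁ a₂ b₂ : ℝ) : Set Plane :=
  {p | 0 < (1 + a₁ * a₂) *
    (MvPolynomial.eval p (lineForm a₁ b₁) * MvPolynomial.eval p (lineForm a₂ b₂))}

/-- Under the deformation `G + ε H` with small `ε > 0`, the two sectors of the cone `K` at the node
`v` of `G = 0` are glued together: at `v` the deformed polynomial, whose value there is `ε H(v)`,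
has the sign that `G` has on `K` near `v`. -/
def ConeMerges (G H : Poly) (v : Plane) (K : Set Plane) : Prop :=
  ∀ᶠ p in 𝓝[K] v, 0 < MvPolynomial.eval v H * MvPolynomial.eval p G

/-- `G + ε H`, for `ε > 0` small, is a small resolution (of the same degree) of the arrangement `G`,
in which at every vertex the wide cone merges, so that the two sectors of the narrow cone stay
disjoint (the narrow cone persists). -/
structure IsNarrowPersistingResolution {d : ℕ} (a b : Fin d → ℝ) (H : Poly) : Prop where
  degree_le : H.totalDegree ≤ d
  merges : ∀ i j, i ≠ j → ∀ v : Plane,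
    v ∈ zeroLocus (lineForm (a i) (b i)) → v ∈ zeroLocus (lineForm (a j) (b j)) →
    ConeMerges (arrangement a b) H v (wideCone (a i) (b i) (a j) (b j))

end RealDiam

end

/-! The arrangement consists of the tangents `y = t c x - t c²` of a flat parabola, with `c = 2 ^
i`. The vertex of two of them is `(c + c', t c c')`; uniqueness of binary expansions keeps the
abscissae of distinct vertices at least 1 apart, and for small `t` all lines, and all segments
between vertices, are nearly horizontal. The perturbation `H` is `smoothing`, the sum of all
products of `d - 2` line forms. At a vertex it equals the product of the other forms, so at scale `s
= √ε` the curve there tends to the hyperbola `X Y = -1`, where `X` and `Y` are the rescaled forms of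
the two lines; its two branches lie in the narrow sectors.

This gives `d (d - 1)` branches, and any two of them are joined by a diameter. At distinct vertices
each limiting branch has a point whose normal is parallel to the line through the vertices; at the
same vertex the two apices are joined. Both limits are nondegenerate solutions of the rescaled
equations, so they persist for small `ε` (`Node.eventually_exists_of_ne`,
`Node.eventually_exists_of_node`, via `eventually_exists_zero`). The number of pairs is `(d² -
d).choose 2`, which is the bound.

The remaining properties come from one principle: a counterexample yields a point of the curve over
a field `K ⊇ ℝ` with a transcendental coordinate, hence infinite for a valuation trivial on `ℝ`. As
`deg H ≤ d - 2`, `asymptote` puts such a point infinitely near one of the lines, with gradient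
nearly normal to it. This excludes multiple factors, circles, and infinite families of diameters: in
such a family the length would be constant, yet both ends would be infinitely near the same line
with the segment nearly normal to it. The same method with `ε` infinitesimal excludes singular
points for small `ε` (`not_singular_of_valuation_lt_one`). -/

namespace RealDiam

open MvPolynomial

/-! ### Valuations, derivations and generic points over the reals. -/

/-- A transcendental element is a pole of some valuation that is trivial on the constants. -/
theorem exists_valuation_one_lt {K : Type} [Field K] [Algebra ℝ K] {τ : K}
    (hτ : Transcendental ℝ τ) :
    ∃ O : ValuationSubring K, (∀ r : ℝ, O.valuation (algebraMap ℝ K r) ≤ 1) ∧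
      1 < O.valuation τ := by
  have hτ0 : τ ≠ 0 := fun h => hτ (h ▸ isAlgebraic_zero)
  -- The ideal `(τ⁻¹)` of `ℝ[τ⁻¹]` is proper: a relation `τ⁻¹ p(τ⁻¹) = 1` would make `τ` algebraic.
  -- A valuation ring containing `ℝ[τ⁻¹]` in which this ideal consists of nonunits is the one
  -- sought.
  let A : Subalgebra ℝ K := Algebra.adjoin ℝ {τ⁻¹}
  let t : A := ⟨τ⁻¹, Algebra.self_mem_adjoin_singleton ℝ _⟩
  have hI : Ideal.span {t} ≠ ⊤ := by
    rw [Ne, Ideal.span_singleton_eq_top]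
    rintro ⟨u, hu⟩
    have hmul : (t : K) * ((u⁻¹ : Aˣ) : A) = 1 := by
      have := u.mul_inv
      rw [hu] at this
      exact_mod_cast congrArg (Subtype.val) this
    have hinv : (((u⁻¹ : Aˣ) : A) : K) = τ := by
      have h2 : τ⁻¹ * (((u⁻¹ : Aˣ) : A) : K) = 1 := hmul
      field_simp at h2
      exact h2
    have hmem : τ ∈ A := by
      rw [← hinv]
      exact ((u⁻¹ : Aˣ) : A).2
    change τ ∈ Algebra.adjoin ℝ {τ⁻¹} at hmem
    rw [Algebra.adjoin_singleton_eq_range_aeval] at hmem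
    obtain ⟨p, hp⟩ := hmem
    refine hτ ?_
    rw [← IsAlgebraic.inv_iff]
    refine ⟨Polynomial.X * p - 1, ?_, ?_⟩
    · intro h0
      have := congrArg (Polynomial.eval 0) h0
      simp at this
    · have hp' : Polynomial.aeval τ⁻¹ p = τ := hp
      simp [hp', hτ0]
  obtain ⟨O, hO, hO'⟩ := Ideal.image_subset_nonunits_valuationSubring (A := A.toSubring)
    (Ideal.span {t}) hI
  refine ⟨O, fun r => ?_, ?_⟩
  · rw [ValuationSubring.valuation_le_one_iff]
    exact hO (A.algebraMap_mem r)
  · have h1 : τ⁻¹ ∈ O.nonunits := hO' ⟨t, Ideal.subset_span rfl, rfl⟩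
    rw [ValuationSubring.mem_nonunits_iff] at h1
    rw [map_inv₀] at h1
    have h0 : O.valuation τ ≠ 0 := by simpa using hτ0
    exact (inv_lt_one₀ (zero_lt_iff.2 h0)).1 h1

/-- Lifting along a square-zero extension with a prescribed value at a transcendental element. -/
theorem exists_section_of_transcendental {K B : Type} [Field K] [Algebra ℝ K] [CommRing B]
    [Algebra ℝ B] {τ : K} (hτ : Transcendental ℝ τ) (g₀ : B →ₐ[ℝ] K)
    (hg : Function.Surjective g₀) (hker : ∀ x y : B, g₀ x = 0 → g₀ y = 0 → x * y = 0)
    {w : B} (hw : g₀ w = τ) : ∃ σ : K →ₐ[ℝ] B, (∀ x, g₀ (σ x) = x) ∧ σ τ = w := by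
  have hinj : Function.Injective (Polynomial.aeval (R := ℝ) τ) :=
    transcendental_iff_injective.1 hτ
  -- `K` is formally smooth over `ℝ[X]` via `X ↦ τ`: a localization, followed by an extension of
  -- fields of characteristic zero, which is purely transcendental and then separable algebraic.
  -- Making `B` an `ℝ[X]`-algebra via `X ↦ w` forces the lift to send `τ` to `w`.
  let a1 : Algebra (Polynomial ℝ) K := (Polynomial.aeval (R := ℝ) τ).toRingHom.toAlgebra
  have : IsScalarTower ℝ (Polynomial ℝ) K := .of_algHom (Polynomial.aeval (R := ℝ) τ)
  have hinj' : Function.Injective (algebraMap (Polynomial ℝ) K) := hinj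
  have : FaithfulSMul (Polynomial ℝ) K := (faithfulSMul_iff_algebraMap_injective _ _).2 hinj'
  let F := FractionRing (Polynomial ℝ)
  let a2 : Algebra F K := FractionRing.liftAlgebra (Polynomial ℝ) K
  have : IsScalarTower (Polynomial ℝ) F K := FractionRing.isScalarTower_liftAlgebra _ _
  have : Algebra.FormallySmooth (Polynomial ℝ) F := .of_isLocalization (nonZeroDivisors _)
  have : Algebra.FormallySmooth F K := by
    have : CharZero F := algebraRat.charZero F
    obtain ⟨s, hs⟩ := exists_isTranscendenceBasis F K
    have : Algebra.IsAlgebraic (IntermediateField.adjoin F (Set.range (Subtype.val : s → K))) K :=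
      hs.isAlgebraic_field
    exact .of_algebraicIndependent_of_isSeparable hs.1
  have : Algebra.FormallySmooth (Polynomial ℝ) K := .comp _ F _
  let a3 : Algebra (Polynomial ℝ) B := (Polynomial.aeval (R := ℝ) w).toRingHom.toAlgebra
  have : IsScalarTower ℝ (Polynomial ℝ) B := .of_algHom (Polynomial.aeval (R := ℝ) w)
  have hg0 : ∀ p : Polynomial ℝ, g₀ (Polynomial.aeval w p) = Polynomial.aeval τ p := by
    intro p
    rw [← Polynomial.aeval_algHom_apply, hw]
  let g : B →ₐ[Polynomial ℝ] K := { g₀.toRingHom with commutes' := hg0 }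
  have hgn : IsNilpotent (RingHom.ker (g : B →+* K)) := by
    refine ⟨2, ?_⟩
    rw [Ideal.zero_eq_bot, eq_bot_iff, sq (RingHom.ker (g : B →+* K)), Ideal.mul_le]
    intro x hx y hy
    exact hker x y hx hy
  let σ : K →ₐ[Polynomial ℝ] B :=
    Algebra.FormallySmooth.liftOfSurjective (AlgHom.id _ K) g hg hgn
  have hσ : ∀ x, g₀ (σ x) = x := fun x =>
    Algebra.FormallySmooth.liftOfSurjective_apply (AlgHom.id _ K) g hg hgn x
  refine ⟨σ.restrictScalars ℝ, hσ, ?_⟩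
  have h1 : algebraMap (Polynomial ℝ) K Polynomial.X = τ := Polynomial.aeval_X (R := ℝ) τ
  have h2 : algebraMap (Polynomial ℝ) B Polynomial.X = w := Polynomial.aeval_X (R := ℝ) w
  change σ τ = w
  rw [← h1, σ.commutes, h2]

/-- In characteristic zero some derivation does not kill a given transcendental element. -/
theorem exists_derivation_ne_zero {K : Type} [Field K] [Algebra ℝ K] {τ : K}
    (hτ : Transcendental ℝ τ) : ∃ D : Derivation ℝ K K, D τ ≠ 0 := by
  -- A section into the dual numbers with `τ ↦ τ + ϵ`; its `ϵ`-part is a derivation with value 1 at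
  -- `τ`.
  obtain ⟨σ, hσ, hστ⟩ := exists_section_of_transcendental hτ (TrivSqZeroExt.fstHom ℝ K K)
    (fun x => ⟨TrivSqZeroExt.inl x, rfl⟩)
    (fun x y hx hy => by
      have hx' : x.fst = 0 := hx
      have hy' : y.fst = 0 := hy
      ext <;> simp [hx', hy'])
    (w := TrivSqZeroExt.inl τ + TrivSqZeroExt.inr 1) (by simp)
  have hσ' : ∀ x, (σ x).fst = x := hσ
  let D : K →ₗ[ℝ] K :=
    { toFun := fun x => (σ x).snd
      map_add' := fun x y => by simp
      map_smul' := fun r x => by simp }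
  refine ⟨Derivation.mk' D fun a b => ?_, ?_⟩
  · change (σ (a * b)).snd = a • (σ b).snd + b • (σ a).snd
    rw [map_mul, TrivSqZeroExt.snd_mul, hσ', hσ']
    simp [mul_comm]
  · change (σ τ).snd ≠ 0
    rw [hστ]
    simp

theorem derivation_aeval {ι K : Type} [Fintype ι] [Field K] [Algebra ℝ K] (D : Derivation ℝ K K)
    (P : ι → K) (g : MvPolynomial ι ℝ) :
    D (aeval P g) = ∑ i, aeval P (pderiv i g) * D (P i) := by
  classical
  induction g using MvPolynomial.induction_on with
  | C a => simp
  | add p q hp hq => simp [hp, hq, add_mul, Finset.sum_add_distrib]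
  | mul_X p i hp =>
    simp only [map_mul, aeval_X, Derivation.leibniz, hp, smul_eq_mul, pderiv_X, map_add, add_mul,
      Finset.sum_add_distrib, Finset.mul_sum]
    congr 1
    · rw [Finset.sum_eq_single i]
      · simp
      · intro b _ hb
        simp [Ne.symm hb]
      · simp
    · exact Finset.sum_congr rfl fun j _ => by ring

/-- An infinite set of real points has a nonstandard member with a transcendental coordinate. -/
theorem exists_generic_point {ι : Type} (S : Set (ι → ℝ)) (i₀ : ι)
    (h : ((fun s : ι → ℝ => s i₀) '' S).Infinite) :
    ∃ (K : Type) (_ : Field K) (_ : Algebra ℝ K) (P : ι → K),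
      (∀ g : MvPolynomial ι ℝ, (∀ s ∈ S, eval s g = 0) → aeval P g = 0) ∧
      (∀ g : MvPolynomial ι ℝ, (∀ s ∈ S, eval s g ≠ 0) → aeval P g ≠ 0) ∧
      Transcendental ℝ (P i₀) := by
  -- Along an ultrafilter finer than `l`, the coordinate `i₀` avoids every finite set, in particular
  -- the roots of any nonzero real polynomial. `K` is the corresponding ultrapower of `ℝ` and `P` is
  -- the tautological point.
  let l : Filter S := Filter.comap (fun s : S => s.1 i₀) Filter.cofinite
  have : l.NeBot := by
    rw [Filter.comap_neBot_iff]
    intro t ht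
    obtain ⟨x, ⟨s, hs, rfl⟩, hx⟩ := (h.sdiff (Filter.mem_cofinite.1 ht)).nonempty
    exact ⟨⟨s, hs⟩, not_not.1 hx⟩
  let U : Ultrafilter S := Ultrafilter.of l
  have hU : (U : Filter S) ≤ l := Ultrafilter.of_le l
  let K := Filter.Germ (U : Filter S) ℝ
  let : Field K := Filter.Germ.instField
  let γ : (S → ℝ) →+* K := Filter.Germ.coeRingHom _
  let : Algebra ℝ K := (γ.comp (Pi.constRingHom S ℝ)).toAlgebra
  let P : ι → K := fun i => γ fun s => s.1 i
  have hγ : ∀ u : S → ℝ, γ u = 0 ↔ ∀ᶠ s in (U : Filter S), u s = 0 := fun u =>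
    Filter.Germ.coe_eq (g := fun _ => (0 : ℝ))
  have hP : ∀ g : MvPolynomial ι ℝ, aeval P g = γ fun s => eval s.1 g := by
    intro g
    induction g using MvPolynomial.induction_on with
    | C a => simp only [algHom_C, eval_C]; rfl
    | add p q hp hq => rw [map_add, hp, hq, ← map_add]; simp only [map_add]; rfl
    | mul_X p i hp => rw [map_mul, hp, aeval_X, ← map_mul]; simp only [map_mul, eval_X]; rfl
  refine ⟨K, inferInstance, inferInstance, P, fun g hg => ?_, fun g hg => ?_, ?_⟩
  · rw [hP, hγ]
    exact Filter.Eventually.of_forall fun s => hg s.1 s.2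
  · rw [hP, Ne, hγ]
    intro h0
    obtain ⟨s, hs⟩ := h0.exists
    exact hg s.1 s.2 hs
  · rintro ⟨p, hp0, hp⟩
    have hp' : γ (fun s => p.eval (s.1 i₀)) = 0 := by
      have := hP (Polynomial.aeval (X i₀) p)
      rw [← Polynomial.aeval_algHom_apply, aeval_X, hp] at this
      rw [this]
      congr 1
      ext s
      rw [← coe_aeval_eq_eval]
      change _ = (aeval s.1) _
      rw [← Polynomial.aeval_algHom_apply, aeval_X, Polynomial.coe_aeval_eq_eval]
    rw [hγ] at hp'
    have hfin : ∀ᶠ s in (U : Filter S), p.eval (s.1 i₀) ≠ 0 := by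
      refine hU (Filter.preimage_mem_comap (Filter.mem_cofinite.2 ?_) :
        (fun s : S => s.1 i₀) ⁻¹' {x | p.eval x ≠ 0} ∈ l)
      refine (Polynomial.finite_setOfPred_isRoot hp0).subset fun x hx => ?_
      simpa using hx
    obtain ⟨s, hs1, hs2⟩ := (hp'.and hfin).exists
    exact hs2 hs1

/-! ### Valuations trivial on the reals, and the line forms. -/

section valuation

variable {K Γ : Type} [Field K] [Algebra ℝ K] [LinearOrderedCommGroupWithZero Γ]
  {v : Valuation K Γ}

theorem valuation_real (hv : ∀ r : ℝ, v (algebraMap ℝ K r) ≤ 1) {r : ℝ} (hr : r ≠ 0) :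
    v (algebraMap ℝ K r) = 1 := by
  refine le_antisymm (hv r) ?_
  have h := hv r⁻¹
  rw [map_inv₀, map_inv₀] at h
  have h0 : v (algebraMap ℝ K r) ≠ 0 := by simpa using hr
  exact (inv_le_one₀ (zero_lt_iff.2 h0)).1 h

/-- In a monic real equation for an element of value greater than 1 the leading term would dominate
all others. The same bound for the inverse gives equality. -/
theorem valuation_algebraic (hv : ∀ r : ℝ, v (algebraMap ℝ K r) ≤ 1) {x : K}
    (hx : IsAlgebraic ℝ x) (hx0 : x ≠ 0) : v x = 1 := by
  have key : ∀ y : K, IsAlgebraic ℝ y → v y ≤ 1 := by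
    intro y hy
    by_contra! h
    obtain ⟨p, hp, hpy⟩ := hy.isIntegral
    have h1 : v (y ^ p.natDegree) ≤ v y ^ (p.natDegree - 1) := by
      rw [← Polynomial.aeval_def, Polynomial.aeval_eq_sum_range, Finset.sum_range_succ,
        hp.coeff_natDegree, one_smul] at hpy
      rw [← neg_eq_of_add_eq_zero_right hpy, Valuation.map_neg]
      refine Valuation.map_sum_le _ fun i hi => ?_
      rw [Algebra.smul_def, map_mul, map_pow]
      refine (mul_le_of_le_one_left' (hv _)).trans ?_
      exact pow_le_pow_right₀ h.le (by have := Finset.mem_range.1 hi; omega)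
    rw [map_pow] at h1
    rcases Nat.eq_zero_or_pos p.natDegree with h2 | h2
    · rw [hp.natDegree_eq_zero.1 h2] at hpy
      simp at hpy
    · exact absurd h1 (not_le.2 (pow_lt_pow_right₀ h (by omega)))
  refine le_antisymm (key x hx) ?_
  have h := key x⁻¹ hx.inv
  rw [map_inv₀] at h
  have h0 : v x ≠ 0 := by simpa using hx0
  exact (inv_le_one₀ (zero_lt_iff.2 h0)).1 h

theorem valuation_aeval_le (hv : ∀ r : ℝ, v (algebraMap ℝ K r) ≤ 1) {ι : Type} {P : ι → K}
    {M : Γ} (hM : 1 ≤ M) (hP : ∀ i, v (P i) ≤ M) (g : MvPolynomial ι ℝ) {n : ℕ}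
    (hn : g.totalDegree ≤ n) : v (aeval P g) ≤ M ^ n := by
  rw [aeval_def, eval₂_eq]
  refine Valuation.map_sum_le _ fun m hm => ?_
  rw [map_mul, map_prod]
  refine (mul_le_of_le_one_left' (hv _)).trans ?_
  calc ∏ i ∈ m.support, v (P i ^ m i) ≤ ∏ i ∈ m.support, M ^ m i :=
        Finset.prod_le_prod' fun i _ => by rw [map_pow]; exact pow_le_pow_left' (hP i) _
    _ = M ^ (m.sum fun _ e => e) := by rw [Finset.prod_pow_eq_pow_sum]; rfl
    _ ≤ M ^ n := pow_le_pow_right₀ hM ((le_totalDegree hm).trans hn)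

end valuation

theorem totalDegree_pderiv_le {ι : Type} (i : ι) (g : MvPolynomial ι ℝ) :
    (pderiv i g).totalDegree ≤ g.totalDegree := by
  classical
  refine Finset.sup_le fun m hm => ?_
  have h1 : m + Finsupp.single i 1 ∈ g.support := by
    rw [mem_support_iff] at hm ⊢
    rw [coeff_pderiv] at hm
    exact left_ne_zero_of_mul hm
  refine le_trans ?_ (le_totalDegree h1)
  rw [Finsupp.sum_add_index' (fun _ => rfl) (fun _ _ _ => rfl)]
  exact Nat.le_add_right _ _

theorem aeval_lineForm {A : Type} [CommRing A] [Algebra ℝ A] (p : Fin 2 → A) (a b : ℝ) :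
    aeval p (lineForm a b) = p 1 - algebraMap ℝ A a * p 0 - algebraMap ℝ A b := by
  simp [lineForm, aeval_X]

theorem eval_lineForm (p : Plane) (a b : ℝ) :
    eval p (lineForm a b) = p 1 - a * p 0 - b := by
  simp [lineForm]

theorem pderiv_zero_lineForm (a b : ℝ) : pderiv 0 (lineForm a b) = C (-a) := by
  simp [lineForm]

theorem pderiv_one_lineForm (a b : ℝ) : pderiv 1 (lineForm a b) = 1 := by
  simp [lineForm]

theorem totalDegree_lineForm_le (a b : ℝ) : (lineForm a b).totalDegree ≤ 1 := by
  unfold lineForm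
  refine (totalDegree_sub _ _).trans (max_le ((totalDegree_sub _ _).trans (max_le ?_ ?_)) ?_)
  · simp
  · refine (totalDegree_mul _ _).trans ?_
    simp
  · simp

theorem totalDegree_prod_lineForm_le {d : ℕ} (a b : Fin d → ℝ) (s : Finset (Fin d)) :
    (∏ k ∈ s, lineForm (a k) (b k)).totalDegree ≤ s.card := by
  refine (totalDegree_finsetProd _ _).trans ?_
  refine (Finset.sum_le_sum fun k _ => totalDegree_lineForm_le (a k) (b k)).trans ?_
  simp

/-- The product of the line forms other than the `i`-th. -/
noncomputable def cofactor {d : ℕ} (a b : Fin d → ℝ) (i : Fin d) : Poly :=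
  ∏ k ∈ Finset.univ.erase i, lineForm (a k) (b k)

theorem arrangement_eq_mul_cofactor {d : ℕ} (a b : Fin d → ℝ) (i : Fin d) :
    arrangement a b = lineForm (a i) (b i) * cofactor a b i :=
  (Finset.mul_prod_erase _ _ (Finset.mem_univ i)).symm

theorem totalDegree_cofactor_le {d : ℕ} (a b : Fin d → ℝ) (i : Fin d) :
    (cofactor a b i).totalDegree ≤ d - 1 := by
  refine (totalDegree_prod_lineForm_le a b _).trans ?_
  simp

/-- The value at `p` of the `k`-th partial derivative of `G + e H`. -/
noncomputable def gradAt {K : Type} [Field K] [Algebra ℝ K] (G H : Poly) (e : K) (p : Fin 2 → K) (k : Fin 2) :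
    K :=
  aeval p (pderiv k G) + e * aeval p (pderiv k H)

/-! ### Behaviour of the curve at infinity. -/

section valuation

variable {K Γ : Type} [Field K] [Algebra ℝ K] [LinearOrderedCommGroupWithZero Γ]
  {v : Valuation K Γ} {d : ℕ} {a b : Fin d → ℝ} {H : Poly}

/-- At infinity, the curve `G + e H = 0` is asymptotic to one of the lines of the arrangement. -/
theorem asymptote (ha : Function.Injective a) (hH : H = 0 ∨ H.totalDegree + 2 ≤ d)
    (hv : ∀ r : ℝ, v (algebraMap ℝ K r) ≤ 1) {e : K} (he : v e ≤ 1) {p : Fin 2 → K}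
    (hp : 1 < v (p 0) ∨ 1 < v (p 1))
    (hf : aeval p (arrangement a b) + e * aeval p H = 0) :
    1 < v (p 0) ∧ ∃ i, v (aeval p (lineForm (a i) (b i))) < 1 ∧
      gradAt (arrangement a b) H e p 1 ≠ 0 ∧
      v (gradAt (arrangement a b) H e p 0 +
        algebraMap ℝ K (a i) * gradAt (arrangement a b) H e p 1) <
          v (gradAt (arrangement a b) H e p 1) := by
  set M := max (v (p 0)) (v (p 1)) with hM
  have hM1 : 1 < M := lt_max_iff.2 hp
  have hM0 : 0 < M := zero_lt_one.trans hM1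
  have hpM : ∀ i, v (p i) ≤ M := by
    intro i
    fin_cases i
    · exact le_max_left _ _
    · exact le_max_right _ _
  have hsmall : ∀ g : Poly, (g = 0 ∨ g.totalDegree + 2 ≤ d) → v (e * aeval p g) * M ^ 2 ≤ M ^ d := by
    rintro g (rfl | hg)
    · simp
    · have h1 := valuation_aeval_le hv hM1.le hpM g (n := d - 2) (by omega)
      calc v (e * aeval p g) * M ^ 2 ≤ M ^ (d - 2) * M ^ 2 := by
            rw [map_mul]
            gcongr
            exact (mul_le_of_le_one_left' he).trans h1
        _ = M ^ d := by rw [← pow_add]; congr 1; omega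
  have hline : ∀ k, v (p 1 - algebraMap ℝ K (a k) * p 0) = M →
      v (aeval p (lineForm (a k) (b k))) = M := by
    intro k hk
    rw [aeval_lineForm, sub_eq_add_neg, Valuation.map_add_eq_of_lt_left, hk]
    rw [Valuation.map_neg, hk]
    exact (hv _).trans_lt hM1
  have hMd : ∀ n : ℕ, M ^ n < M ^ n * M ^ 2 := fun n =>
    lt_mul_of_one_lt_right (pow_pos hM0 n) (one_lt_pow₀ hM1 two_ne_zero)
  -- Otherwise every line form has the maximal value `M`, and `G` has value `M ^ d`, too large to be
  -- cancelled by `e H`.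
  have hex : ∃ i, v (p 1 - algebraMap ℝ K (a i) * p 0) < M := by
    by_contra! hall
    have hG : v (aeval p (arrangement a b)) = M ^ d := by
      rw [arrangement, map_prod, map_prod, Finset.prod_congr rfl fun k _ => hline k
        (le_antisymm ?_ (hall k))]
      · simp
      · refine (Valuation.map_sub _ _ _).trans (max_le (hpM 1) ?_)
        rw [map_mul]
        exact (mul_le_of_le_one_left' (hv _)).trans (hpM 0)
    have h2 := hsmall H hH
    rw [← neg_eq_of_add_eq_zero_right hf, Valuation.map_neg, hG] at h2
    exact absurd (hMd d) (not_lt.2 h2)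
  obtain ⟨i, hi⟩ := hex
  have hx : v (p 0) = M := by
    refine le_antisymm (hpM 0) (not_lt.1 fun h0 => ?_)
    have h1 : v (p 1) = M := by
      rcases max_choice (v (p 0)) (v (p 1)) with h | h
      · exact absurd (hM.trans h) h0.ne'
      · exact (hM.trans h).symm
    rw [sub_eq_add_neg, Valuation.map_add_eq_of_lt_left, h1] at hi
    · exact hi.false
    · rw [Valuation.map_neg, map_mul, h1]
      exact (mul_le_of_le_one_left' (hv _)).trans_lt h0
  have hd : 1 ≤ d := Nat.one_le_of_lt i.2
  have hR : v (aeval p (cofactor a b i)) = M ^ (d - 1) := by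
    rw [cofactor, map_prod, map_prod, Finset.prod_congr rfl fun k hk => hline k ?_]
    · simp
    · have hk' : a i - a k ≠ 0 := sub_ne_zero.2 fun h => (Finset.ne_of_mem_erase hk) (ha h).symm
      have h1 : v (algebraMap ℝ K (a i - a k) * p 0) = M := by
        rw [map_mul, valuation_real hv hk', one_mul, hx]
      have h2 : p 1 - algebraMap ℝ K (a k) * p 0 =
          algebraMap ℝ K (a i - a k) * p 0 + (p 1 - algebraMap ℝ K (a i) * p 0) := by
        rw [map_sub]; ring
      rw [h2, Valuation.map_add_eq_of_lt_left, h1]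
      rwa [h1]
  have hN0 : 0 < M ^ (d - 1) := pow_pos hM0 _
  have hNd : M ^ d = M ^ (d - 1) * M := by rw [← pow_succ]; congr 1; omega
  have hsmall' : ∀ g : Poly, (g = 0 ∨ g.totalDegree + 2 ≤ d) →
      v (e * aeval p g) < M ^ (d - 1) := by
    intro g hg
    have h1 := hsmall g hg
    rw [hNd, pow_two, ← mul_assoc] at h1
    replace h1 := le_of_mul_le_mul_right h1 hM0
    by_contra! h2
    exact absurd ((lt_mul_of_one_lt_right hN0 hM1).trans_le (mul_le_mul_left h2 M))
      (not_lt.2 h1)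
  -- The other forms contribute exactly `M ^ (d - 1)` to `G`, while `e H` has smaller value because
  -- `deg H ≤ d - 2`; degree `d - 1` would only bound the remaining form.
  have hl : v (aeval p (lineForm (a i) (b i))) < 1 := by
    have h1 := hsmall' H hH
    rw [← neg_eq_of_add_eq_zero_right hf, Valuation.map_neg,
      arrangement_eq_mul_cofactor a b i, map_mul, map_mul, hR] at h1
    exact lt_of_mul_lt_mul_right (by rwa [one_mul]) hN0.le
  have hdH : ∀ k, v (e * aeval p (pderiv k H)) < M ^ (d - 1) := by
    refine fun k => hsmall' _ (hH.imp (fun h => by rw [h, map_zero]) fun h => ?_)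
    have := totalDegree_pderiv_le k H
    omega
  have hdR : ∀ k, v (aeval p (lineForm (a i) (b i)) * aeval p (pderiv k (cofactor a b i))) <
      M ^ (d - 1) := by
    intro k
    have h1 := valuation_aeval_le hv hM1.le hpM (pderiv k (cofactor a b i)) (n := d - 1)
      ((totalDegree_pderiv_le _ _).trans (totalDegree_cofactor_le a b i))
    rw [map_mul]
    calc _ ≤ v (aeval p (lineForm (a i) (b i))) * M ^ (d - 1) := by gcongr
      _ < 1 * M ^ (d - 1) := by gcongr
      _ = _ := one_mul _
  -- The dominant part of the gradient is the cofactor times `(-a i, 1)`.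
  have hg1 : gradAt (arrangement a b) H e p 1 = aeval p (cofactor a b i) +
      (aeval p (lineForm (a i) (b i)) * aeval p (pderiv 1 (cofactor a b i)) +
        e * aeval p (pderiv 1 H)) := by
    simp only [gradAt, arrangement_eq_mul_cofactor a b i, pderiv_mul, pderiv_one_lineForm, map_add,
      map_mul, map_one]
    ring
  have hg0 : gradAt (arrangement a b) H e p 0 = -algebraMap ℝ K (a i) * aeval p (cofactor a b i) +
      (aeval p (lineForm (a i) (b i)) * aeval p (pderiv 0 (cofactor a b i)) +
        e * aeval p (pderiv 0 H)) := by
    simp only [gradAt, arrangement_eq_mul_cofactor a b i, pderiv_mul, pderiv_zero_lineForm, map_add,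
      map_mul, map_neg, algHom_C]
    ring
  have hrest : ∀ k, v (aeval p (lineForm (a i) (b i)) * aeval p (pderiv k (cofactor a b i)) +
        e * aeval p (pderiv k H)) < M ^ (d - 1) := fun k =>
    Valuation.map_add_lt _ (hdR k) (hdH k)
  have hvg1 : v (gradAt (arrangement a b) H e p 1) = M ^ (d - 1) := by
    rw [hg1, Valuation.map_add_eq_of_lt_left, hR]
    rw [hR]
    exact hrest 1
  refine ⟨hx ▸ hM1, i, hl, ?_, ?_⟩
  · rw [← v.ne_zero_iff, hvg1]
    exact hN0.ne'
  · have h3 : gradAt (arrangement a b) H e p 0 +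
        algebraMap ℝ K (a i) * gradAt (arrangement a b) H e p 1 =
        (aeval p (lineForm (a i) (b i)) * aeval p (pderiv 0 (cofactor a b i)) +
          e * aeval p (pderiv 0 H)) +
        algebraMap ℝ K (a i) *
        (aeval p (lineForm (a i) (b i)) * aeval p (pderiv 1 (cofactor a b i)) +
          e * aeval p (pderiv 1 H)) := by
      rw [hg0, hg1]; ring
    rw [hvg1, h3]
    refine Valuation.map_add_lt _ (hrest 0) ?_
    rw [map_mul]
    exact (mul_le_of_le_one_left' (hv _)).trans_lt (hrest 1)

end valuation

theorem gradAt_algebraMap {K : Type} [Field K] [Algebra ℝ K] (G H : Poly) (ε : ℝ) (p : Fin 2 → K)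
    (k : Fin 2) : gradAt G H (algebraMap ℝ K ε) p k = aeval p (pderiv k (G + C ε * H)) := by
  simp [gradAt]

theorem perp_of_cross_eq_zero {K : Type} [Field K] {g₀ g₁ u₀ u₁ x y : K}
    (h : g₀ * x + g₁ * y = 0) (hu : u₀ * g₁ = u₁ * g₀) (hg : g₀ ^ 2 + g₁ ^ 2 ≠ 0) :
    u₀ * x + u₁ * y = 0 := by
  have h1 : (g₀ ^ 2 + g₁ ^ 2) * (u₀ * x + u₁ * y) = 0 := by
    linear_combination (u₀ * g₀ + u₁ * g₁) * h + (g₁ * x - g₀ * y) * hu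
  exact (mul_eq_zero.1 h1).resolve_left hg

/-! ### Finiteness of the diameters and absence of circles. -/

section curve

variable {d : ℕ} {a b : Fin d → ℝ} {H : Poly}

/-- No diameter of a small resolution has an endpoint with a transcendental coordinate. -/
theorem not_transcendental_of_diameter (ha : Function.Injective a)
    (hH : H = 0 ∨ H.totalDegree + 2 ≤ d) (ε : ℝ) {K : Type} [Field K] [Algebra ℝ K]
    {f : Poly} (hf : f = arrangement a b + C ε * H) {p q : Fin 2 → K}
    (hp : aeval p f = 0) (hq : aeval q f = 0)
    (hpp : (q 0 - p 0) * aeval p (pderiv 1 f) = (q 1 - p 1) * aeval p (pderiv 0 f))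
    (hqq : (q 0 - p 0) * aeval q (pderiv 1 f) = (q 1 - p 1) * aeval q (pderiv 0 f))
    (hgp : aeval p (pderiv 0 f) ^ 2 + aeval p (pderiv 1 f) ^ 2 ≠ 0)
    (hgq : aeval q (pderiv 0 f) ^ 2 + aeval q (pderiv 1 f) ^ 2 ≠ 0)
    (hpq : (q 0 - p 0) ^ 2 + (q 1 - p 1) ^ 2 ≠ 0) (i₀ : Fin 2) : ¬ Transcendental ℝ (p i₀) := by
  intro htr
  -- First variation of length: a derivation applied to the endpoints gives tangent vectors, which
  -- are orthogonal to the segment. Every derivation thus kills the squared length, which must be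
  -- algebraic.
  have halg : IsAlgebraic ℝ ((q 0 - p 0) ^ 2 + (q 1 - p 1) ^ 2) := by
    by_contra hρ
    obtain ⟨D, hD⟩ := exists_derivation_ne_zero hρ
    apply hD
    have h1 := derivation_aeval D p f
    have h2 := derivation_aeval D q f
    rw [hp, map_zero, Fin.sum_univ_two] at h1
    rw [hq, map_zero, Fin.sum_univ_two] at h2
    have h3 := perp_of_cross_eq_zero h1.symm hpp hgp
    have h4 := perp_of_cross_eq_zero h2.symm hqq hgq
    simp only [map_add, pow_two, Derivation.leibniz, map_sub, smul_eq_mul]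
    linear_combination 2 * h4 - 2 * h3
  obtain ⟨O, hv, hO⟩ := exists_valuation_one_lt htr
  set v := O.valuation with hvdef
  have hvρ := valuation_algebraic hv halg hpq
  have hone : ∀ w : Fin 2 → K, aeval w f = 0 →
      aeval w (arrangement a b) + algebraMap ℝ K ε * aeval w H = 0 := by
    intro w hw
    rw [hf] at hw
    simpa using hw
  have hp' : 1 < v (p 0) ∨ 1 < v (p 1) := by
    fin_cases i₀
    · exact Or.inl hO
    · exact Or.inr hO
  obtain ⟨hx, i, hli, hg1, hg⟩ := asymptote ha hH hv (hv ε) hp' (hone p hp)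
  simp only [gradAt_algebraMap, ← hf] at hg1 hg
  set g₀ := aeval p (pderiv 0 f)
  set g₁ := aeval p (pderiv 1 f)
  set α := algebraMap ℝ K (a i) with hα
  set η := (g₀ + α * g₁) / g₁ with hη
  have hvη : v η < 1 := by
    rw [hη, map_div₀]
    exact (div_lt_one₀ (zero_lt_iff.2 (v.ne_zero_iff.2 hg1))).2 hg
  have hu : q 0 - p 0 = (q 1 - p 1) * (η - α) := by
    rw [hη]
    field_simp
    linear_combination hpp
  have hunit : v (1 + α ^ 2) = 1 := by
    have : (1 + α ^ 2 : K) = algebraMap ℝ K (1 + a i ^ 2) := by simp [hα]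
    rw [this]
    exact valuation_real hv (by positivity)
  have hαη : ∀ c : ℝ, v (η * (η + algebraMap ℝ K c)) < 1 := by
    intro c
    rw [map_mul]
    exact mul_lt_one_of_lt_of_le hvη ((v.map_add _ _).trans (max_le hvη.le (hv c)))
  -- The segment is nearly parallel to the normal `(-a i, 1)` and its squared length has value 1, so
  -- its second component has value 1.
  have hu1 : v (q 1 - p 1) = 1 := by
    have h1 : (q 0 - p 0) ^ 2 + (q 1 - p 1) ^ 2 =
        (q 1 - p 1) ^ 2 * ((1 + α ^ 2) + η * (η + algebraMap ℝ K (-2 * a i))) := by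
      rw [hu, map_mul, ← hα, map_neg, map_ofNat]; ring
    rw [h1, map_mul, Valuation.map_add_eq_of_lt_left, hunit, mul_one, map_pow] at hvρ
    · exact (pow_eq_one_iff_of_nonneg zero_le two_ne_zero).1 hvρ
    · rw [hunit]; exact hαη _
  have hu0 : v (q 0 - p 0) ≤ 1 := by
    rw [hu, map_mul, hu1, one_mul]
    exact (v.map_sub _ _).trans (max_le hvη.le (hv _))
  have hqx : v (q 0) = v (p 0) := by
    have : q 0 = p 0 + (q 0 - p 0) := by ring
    rw [this, Valuation.map_add_eq_of_lt_left]
    exact hu0.trans_lt hx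
  obtain ⟨-, j, hlj, -⟩ := asymptote ha hH hv (hv ε) (Or.inl (hqx ▸ hx)) (hone q hq)
  -- Points infinitely near two nonparallel lines are infinitely far apart at infinity, but the
  -- segment is bounded.
  have hij : j = i := by
    by_contra hne
    have h1 : v (algebraMap ℝ K (a i - a j) * p 0) = v (p 0) := by
      rw [map_mul, valuation_real hv (sub_ne_zero.2 fun h => hne (ha h).symm), one_mul]
    have h2 : algebraMap ℝ K (a i - a j) * p 0 = (aeval q (lineForm (a j) (b j)) -
        aeval p (lineForm (a i) (b i))) - ((q 1 - p 1) - algebraMap ℝ K (a j) * (q 0 - p 0)) -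
        algebraMap ℝ K (b i - b j) := by
      rw [aeval_lineForm, aeval_lineForm, map_sub, map_sub]; ring
    have h3 : v (algebraMap ℝ K (a i - a j) * p 0) ≤ 1 := by
      rw [h2]
      refine (v.map_sub _ _).trans (max_le ((v.map_sub _ _).trans (max_le
        ((v.map_sub _ _).trans (max_le hlj.le hli.le))
        ((v.map_sub _ _).trans (max_le hu1.le ?_)))) (hv _))
      rw [map_mul]
      exact mul_le_one' (hv _) hu0
    exact absurd hx (not_lt.2 (h1 ▸ h3))
  subst hij
  -- Along a nearly normal segment of finite length the line form changes by a quantity of value 1,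
  -- although it has value below 1 at both ends.
  have h1 : aeval q (lineForm (a j) (b j)) - aeval p (lineForm (a j) (b j)) =
      (q 1 - p 1) * ((1 + α ^ 2) - η * α) := by
    have hq0 : q 0 = p 0 + (q 1 - p 1) * (η - α) := by rw [← hu]; ring
    rw [aeval_lineForm, aeval_lineForm, hq0]; ring
  have h2 : v ((q 1 - p 1) * ((1 + α ^ 2) - η * α)) = 1 := by
    rw [map_mul, hu1, one_mul, sub_eq_add_neg, Valuation.map_add_eq_of_lt_left, hunit]
    rw [hunit, Valuation.map_neg, map_mul]
    exact mul_lt_one_of_lt_of_le hvη (hv _)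
  rw [← h1] at h2
  exact absurd h2 (v.map_sub_lt hlj hli).ne

end curve

theorem PerpToTangent.cross_eq {f : Poly} {p u : Plane} (h : PerpToTangent f p u) :
    u 0 * eval p (pderiv 1 f) = u 1 * eval p (pderiv 0 f) := by
  have h1 := h ![-eval p (pderiv 1 f), eval p (pderiv 0 f)] (by simp [dotProduct, grad]; ring)
  simp [dotProduct] at h1
  linarith

theorem perpToTangent_of_cross_eq {f : Poly} {p u : Plane} (hg : grad f p ≠ 0)
    (h : u 0 * eval p (pderiv 1 f) = u 1 * eval p (pderiv 0 f)) : PerpToTangent f p u := by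
  intro w hw
  simp only [dotProduct, Fin.sum_univ_two] at hw ⊢
  refine perp_of_cross_eq_zero hw h fun h0 => hg ?_
  have h1 : grad f p 0 = 0 := by nlinarith [sq_nonneg (grad f p 0), sq_nonneg (grad f p 1)]
  have h2 : grad f p 1 = 0 := by nlinarith [sq_nonneg (grad f p 0), sq_nonneg (grad f p 1)]
  ext i
  fin_cases i
  · exact h1
  · exact h2

theorem sq_add_sq_ne_zero {x : Plane} (hx : x ≠ 0) : x 0 ^ 2 + x 1 ^ 2 ≠ 0 := by
  intro h0
  apply hx
  have h1 : x 0 = 0 := by nlinarith [sq_nonneg (x 0), sq_nonneg (x 1)]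
  have h2 : x 1 = 0 := by nlinarith [sq_nonneg (x 0), sq_nonneg (x 1)]
  ext i
  fin_cases i
  · exact h1
  · exact h2

theorem exists_infinite_coordinate {ι : Type} [Finite ι] {S : Set (ι → ℝ)} (hS : S.Infinite) :
    ∃ i, ((fun s : ι → ℝ => s i) '' S).Infinite := by
  by_contra! h
  refine hS ((Set.Finite.pi' h).subset fun s hs i => ⟨s, hs, rfl⟩)

section curve

variable {d : ℕ} {a b : Fin d → ℝ} {H : Poly}

/-- A curve with pairwise nonparallel real asymptotes has finitely many diameters. -/
theorem finite_diameters (ha : Function.Injective a) (hH : H = 0 ∨ H.totalDegree + 2 ≤ d)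
    (ε : ℝ) : (diameters (arrangement a b + C ε * H)).Finite := by
  set f := arrangement a b + C ε * H with hf
  by_contra hinf
  -- Ordered pairs of endpoints, viewed as points of four-space; a generic such pair has a
  -- transcendental coordinate at one of its ends.
  let S : Set (Fin 2 ⊕ Fin 2 → ℝ) := {s | s ∘ Sum.inl ≠ s ∘ Sum.inr ∧
    IsNonsingularPoint f (s ∘ Sum.inl) ∧ IsNonsingularPoint f (s ∘ Sum.inr) ∧
    PerpToTangent f (s ∘ Sum.inl) (s ∘ Sum.inr - s ∘ Sum.inl) ∧
    PerpToTangent f (s ∘ Sum.inr) (s ∘ Sum.inr - s ∘ Sum.inl)}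
  have hS : S.Infinite := by
    intro hfin
    refine hinf ((hfin.image fun s => s(s ∘ Sum.inl, s ∘ Sum.inr)).subset ?_)
    rintro _ ⟨p, q, rfl, h⟩
    exact ⟨Sum.elim p q, h, rfl⟩
  obtain ⟨i, hi⟩ := exists_infinite_coordinate hS
  obtain ⟨K, _, _, P, hP0, hP1, htr⟩ := exists_generic_point S i hi
  have hren : ∀ (h : Fin 2 → Fin 2 ⊕ Fin 2) (g : Poly) (s : Fin 2 ⊕ Fin 2 → ℝ),
      eval s (rename h g) = eval (s ∘ h) g := fun h g s => eval_rename _ _ _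
  have hzero : ∀ h : Fin 2 → Fin 2 ⊕ Fin 2, (∀ s ∈ S, IsNonsingularPoint f (s ∘ h)) →
      aeval (P ∘ h) f = 0 := by
    intro h hh
    rw [← aeval_rename]
    refine hP0 _ fun s hs => ?_
    rw [hren]
    exact (hh s hs).1
  have hgrad : ∀ h : Fin 2 → Fin 2 ⊕ Fin 2, (∀ s ∈ S, IsNonsingularPoint f (s ∘ h)) →
      aeval (P ∘ h) (pderiv 0 f) ^ 2 + aeval (P ∘ h) (pderiv 1 f) ^ 2 ≠ 0 := by
    intro h hh
    have := hP1 (rename h (pderiv 0 f) ^ 2 + rename h (pderiv 1 f) ^ 2) fun s hs => by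
      simp only [map_add, map_pow, hren]
      exact sq_add_sq_ne_zero (hh s hs).2
    simpa only [map_add, map_pow, aeval_rename] using this
  have hperp : ∀ h : Fin 2 → Fin 2 ⊕ Fin 2,
      (∀ s ∈ S, PerpToTangent f (s ∘ h) (s ∘ Sum.inr - s ∘ Sum.inl)) →
      (P (Sum.inr 0) - P (Sum.inl 0)) * aeval (P ∘ h) (pderiv 1 f) =
        (P (Sum.inr 1) - P (Sum.inl 1)) * aeval (P ∘ h) (pderiv 0 f) := by
    intro h hh
    have := hP0 ((X (Sum.inr 0) - X (Sum.inl 0)) * rename h (pderiv 1 f) -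
      (X (Sum.inr 1) - X (Sum.inl 1)) * rename h (pderiv 0 f)) fun s hs => by
      have := (hh s hs).cross_eq
      simp only [Pi.sub_apply, Function.comp_apply] at this
      simp only [map_sub, map_mul, eval_X, hren, this, sub_self]
    simp only [map_sub, map_mul, aeval_X, aeval_rename] at this
    exact sub_eq_zero.1 this
  have hne : (P (Sum.inr 0) - P (Sum.inl 0)) ^ 2 + (P (Sum.inr 1) - P (Sum.inl 1)) ^ 2 ≠ 0 := by
    have := hP1 ((X (Sum.inr 0) - X (Sum.inl 0)) ^ 2 + (X (Sum.inr 1) - X (Sum.inl 1)) ^ 2)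
      fun s hs => by
        simp only [map_add, map_pow, map_sub, eval_X]
        exact sq_add_sq_ne_zero (sub_ne_zero.2 (Ne.symm hs.1))
    simpa using this
  have hl := fun s (hs : s ∈ S) => hs.2.1
  have hr := fun s (hs : s ∈ S) => hs.2.2.1
  have hpl := hperp Sum.inl fun s hs => hs.2.2.2.1
  have hpr := hperp Sum.inr fun s hs => hs.2.2.2.2
  rcases i with i | i
  · exact not_transcendental_of_diameter ha hH ε hf (p := P ∘ Sum.inl) (q := P ∘ Sum.inr)
      (hzero _ hl) (hzero _ hr) hpl hpr (hgrad _ hl) (hgrad _ hr) hne i htr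
  · refine not_transcendental_of_diameter ha hH ε hf (p := P ∘ Sum.inr) (q := P ∘ Sum.inl)
      (hzero _ hr) (hzero _ hl) ?_ ?_ (hgrad _ hr) (hgrad _ hl) ?_ i htr
    · simp only [Function.comp_apply]
      linear_combination -hpr
    · simp only [Function.comp_apply]
      linear_combination -hpl
    · simp only [Function.comp_apply]
      convert hne using 1
      ring

/-- A circle has no real asymptote: near a line of slope `a i` its equation would make `(1 + a i ²)
x²` at most of the order of `x`, with `x` infinite. -/
theorem not_circlePoly_dvd (ha : Function.Injective a) (hH : H = 0 ∨ H.totalDegree + 2 ≤ d)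
    (ε : ℝ) (c : Plane) {r : ℝ} (hr : 0 < r) : ¬ circlePoly c r ∣ arrangement a b + C ε * H := by
  intro hdvd
  have hinf : ((fun s : Plane => s 0) '' zeroLocus (circlePoly c r)).Infinite := by
    refine (Set.Icc_infinite (by linarith : c 0 - r < c 0 + r)).mono fun x hx => ?_
    refine ⟨![x, c 1 + √(r ^ 2 - (x - c 0) ^ 2)], ?_, rfl⟩
    have : 0 ≤ r ^ 2 - (x - c 0) ^ 2 := by nlinarith [hx.1, hx.2]
    simp [zeroLocus, circlePoly, Real.sq_sqrt this]
  obtain ⟨K, _, _, P, hP0, -, htr⟩ := exists_generic_point _ 0 hinf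
  have hcirc : aeval P (circlePoly c r) = 0 := hP0 _ fun s hs => hs
  have hf : aeval P (arrangement a b) + algebraMap ℝ K ε * aeval P H = 0 := by
    obtain ⟨k, hk⟩ := hdvd
    have := congrArg (aeval P) hk
    simpa [hcirc] using this
  obtain ⟨O, hv, hO⟩ := exists_valuation_one_lt htr
  set v := O.valuation with hvdef
  obtain ⟨hx, i, hl, -⟩ := asymptote ha hH hv (hv ε) (Or.inl hO) hf
  rw [aeval_lineForm] at hl
  set l := P 1 - algebraMap ℝ K (a i) * P 0 - algebraMap ℝ K (b i) with hldef
  have hy : P 1 = algebraMap ℝ K (a i) * P 0 + algebraMap ℝ K (b i) + l := by rw [hldef]; ring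
  set m := l + algebraMap ℝ K (b i - c 1) with hm
  have hvm : v m ≤ 1 := (v.map_add _ _).trans (max_le hl.le (hv _))
  have h1 : algebraMap ℝ K (1 + a i ^ 2) * P 0 * P 0 =
      -((algebraMap ℝ K (2 * a i) * m - algebraMap ℝ K (2 * c 0)) * P 0 +
        (m * m + algebraMap ℝ K (c 0 ^ 2 - r ^ 2))) := by
    simp only [circlePoly, map_sub, map_add, map_pow, aeval_X, algHom_C, hy] at hcirc
    simp only [hm, map_add, map_one, map_pow, map_mul, map_sub, map_ofNat]
    linear_combination hcirc
  have h2 : v (algebraMap ℝ K (1 + a i ^ 2) * P 0 * P 0) ≤ v (P 0) := by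
    rw [h1, Valuation.map_neg]
    refine (v.map_add _ _).trans (max_le ?_ (((v.map_add _ _).trans (max_le ?_ (hv _))).trans hx.le))
    · rw [map_mul]
      refine mul_le_of_le_one_left' ((v.map_sub _ _).trans (max_le ?_ (hv _)))
      rw [map_mul]
      exact mul_le_one' (hv _) hvm
    · rw [map_mul]
      exact mul_le_one' hvm hvm
  rw [map_mul, map_mul, valuation_real hv (by positivity), one_mul] at h2
  exact absurd h2 (not_le.2 (lt_mul_of_one_lt_right (zero_lt_one.trans hx) hx))

end curve

/-! ### The smoothing polynomial and nonsingularity of the resolution. -/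

section curve

variable {d : ℕ}

/-- The product of the line forms other than the `i`-th and the `j`-th. -/
noncomputable def cofactor₂ (a b : Fin d → ℝ) (i j : Fin d) : Poly :=
  ∏ k ∈ ({i, j} : Finset (Fin d))ᶜ, lineForm (a k) (b k)

/-- The sum of all products of `d - 2` of the line forms. -/
noncomputable def smoothing (a b : Fin d → ℝ) : Poly :=
  ∑ s ∈ (Finset.univ : Finset (Fin d)).powersetCard 2, ∏ k ∈ sᶜ, lineForm (a k) (b k)

theorem arrangement_eq_mul_cofactor₂ (a b : Fin d → ℝ) {i j : Fin d} (hij : i ≠ j) :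
    arrangement a b = lineForm (a i) (b i) * lineForm (a j) (b j) * cofactor₂ a b i j := by
  rw [arrangement, ← Finset.prod_mul_prod_compl {i, j}, Finset.prod_pair hij, cofactor₂]

theorem smoothing_eq_zero_or (a b : Fin d → ℝ) :
    smoothing a b = 0 ∨ (smoothing a b).totalDegree + 2 ≤ d := by
  rcases lt_or_ge d 2 with h | h
  · left
    rw [smoothing, Finset.powersetCard_eq_empty.2 (by simpa using h), Finset.sum_empty]
  · right
    have : (smoothing a b).totalDegree ≤ d - 2 := by
      refine totalDegree_finsetSum_le fun s hs => ?_
      refine (totalDegree_prod_lineForm_le a b _).trans ?_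
      rw [Finset.card_compl, (Finset.mem_powersetCard.1 hs).2, Fintype.card_fin]
    omega

/-- Every other summand omits a different pair of lines, hence retains the factor of line `i` or of
line `j`. -/
theorem exists_smoothing_eq (a b : Fin d → ℝ) {i j : Fin d} (hij : i ≠ j) :
    ∃ B C : Poly, smoothing a b =
      cofactor₂ a b i j + lineForm (a i) (b i) * B + lineForm (a j) (b j) * C := by
  have hmem : ({i, j} : Finset (Fin d)) ∈ (Finset.univ : Finset (Fin d)).powersetCard 2 :=
    Finset.mem_powersetCard.2 ⟨Finset.subset_univ _, Finset.card_pair hij⟩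
  have h : smoothing a b - cofactor₂ a b i j ∈
      Ideal.span {lineForm (a i) (b i), lineForm (a j) (b j)} := by
    rw [smoothing, ← Finset.add_sum_erase _ _ hmem, cofactor₂, add_sub_cancel_left]
    refine Ideal.sum_mem _ fun s hs => ?_
    obtain ⟨hne, hs⟩ := Finset.mem_erase.1 hs
    have hex : i ∈ sᶜ ∨ j ∈ sᶜ := by
      by_contra! hcon
      simp only [Finset.mem_compl, not_not] at hcon
      refine hne (Finset.eq_of_subset_of_card_le ?_ ?_).symm
      · simp [Finset.insert_subset_iff, hcon]
      · rw [(Finset.mem_powersetCard.1 hs).2, Finset.card_pair hij]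
    rcases hex with h | h
    · exact Ideal.mem_of_dvd _ (Finset.dvd_prod_of_mem _ h) (Ideal.subset_span (by simp))
    · exact Ideal.mem_of_dvd _ (Finset.dvd_prod_of_mem _ h) (Ideal.subset_span (by simp))
  obtain ⟨B, C, hBC⟩ := Ideal.mem_span_pair.1 h
  exact ⟨B, C, by linear_combination -hBC⟩

/-- The intersection point of two lines. -/
noncomputable def vertex (a₁ b₁ a₂ b₂ : ℝ) : Plane :=
  ![(b₂ - b₁) / (a₁ - a₂), a₁ * ((b₂ - b₁) / (a₁ - a₂)) + b₁]

theorem vertex_mem_left (a₁ b₁ a₂ b₂ : ℝ) : vertex a₁ b₁ a₂ b₂ ∈ zeroLocus (lineForm a₁ b₁) := by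
  simp [zeroLocus, eval_lineForm, vertex]

theorem vertex_mem_right {a₁ b₁ a₂ b₂ : ℝ} (h : a₁ ≠ a₂) :
    vertex a₁ b₁ a₂ b₂ ∈ zeroLocus (lineForm a₂ b₂) := by
  have : a₁ - a₂ ≠ 0 := sub_ne_zero.2 h
  simp only [zeroLocus, Set.mem_ofPred_eq, eval_lineForm, vertex, Matrix.cons_val_zero,
    Matrix.cons_val_one]
  field_simp
  ring

variable {a b : Fin d → ℝ}

theorem StronglyGeneric.injective (h : StronglyGeneric a b) : Function.Injective a := by
  intro i j hij
  by_contra hne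
  exact h.not_parallel i j hne hij

section valuation

variable {K Γ : Type} [Field K] [Algebra ℝ K] [LinearOrderedCommGroupWithZero Γ]
  {v : Valuation K Γ}

/-- The third form is a real combination of the first two plus a constant proportional to its value
at their vertex, which is nonzero since no three lines concur. -/
theorem valuation_third_line (h : StronglyGeneric a b)
    (hv : ∀ r : ℝ, v (algebraMap ℝ K r) ≤ 1) {p : Fin 2 → K} {i j k : Fin d} (hij : i ≠ j)
    (hik : i ≠ k) (hjk : j ≠ k) (hi : v (aeval p (lineForm (a i) (b i))) < 1)
    (hj : v (aeval p (lineForm (a j) (b j))) < 1) : v (aeval p (lineForm (a k) (b k))) = 1 := by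
  have ha := h.not_parallel i j hij
  set u := vertex (a i) (b i) (a j) (b j)
  have hui : u ∈ zeroLocus (lineForm (a i) (b i)) := vertex_mem_left _ _ _ _
  have huj : u ∈ zeroLocus (lineForm (a j) (b j)) := vertex_mem_right ha
  have huk : eval u (lineForm (a k) (b k)) ≠ 0 := h.not_concurrent i j k hij hik hjk u hui huj
  have hui' : u 1 - a i * u 0 - b i = 0 := by simpa [zeroLocus, eval_lineForm] using hui
  have huj' : u 1 - a j * u 0 - b j = 0 := by simpa [zeroLocus, eval_lineForm] using huj
  rw [eval_lineForm] at huk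
  have h1 : algebraMap ℝ K (a i - a j) * aeval p (lineForm (a k) (b k)) =
      algebraMap ℝ K ((a i - a j) * (u 1 - a k * u 0 - b k)) +
        (algebraMap ℝ K (a i - a j) * aeval p (lineForm (a i) (b i)) + algebraMap ℝ K (a i - a k) *
        (aeval p (lineForm (a j) (b j)) - aeval p (lineForm (a i) (b i)))) := by
    have e1 : b i = u 1 - a i * u 0 := by linarith
    have e2 : b j = u 1 - a j * u 0 := by linarith
    simp only [aeval_lineForm, e1, e2, map_sub, map_mul]
    ring
  have h2 : v (algebraMap ℝ K (a i - a j) * aeval p (lineForm (a k) (b k))) = 1 := by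
    rw [h1, Valuation.map_add_eq_of_lt_left,
      valuation_real hv (mul_ne_zero (sub_ne_zero.2 ha) huk)]
    rw [valuation_real hv (mul_ne_zero (sub_ne_zero.2 ha) huk)]
    refine v.map_add_lt ?_ ?_
    · rw [map_mul]
      exact (mul_le_of_le_one_left' (hv _)).trans_lt hi
    · rw [map_mul]
      exact (mul_le_of_le_one_left' (hv _)).trans_lt (v.map_sub_lt hj hi)
  rwa [map_mul, valuation_real hv (sub_ne_zero.2 ha), one_mul] at h2

/-- For infinitesimal `e ≠ 0` the curve `G + e H = 0` has no singular point. -/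
theorem not_singular_of_valuation_lt_one (h : StronglyGeneric a b)
    (hv : ∀ r : ℝ, v (algebraMap ℝ K r) ≤ 1) {e : K} (he : v e < 1) (he0 : e ≠ 0)
    {p : Fin 2 → K} (hf : aeval p (arrangement a b) + e * aeval p (smoothing a b) = 0)
    (hg : ∀ k, gradAt (arrangement a b) (smoothing a b) e p k = 0) : False := by
  by_cases hp : 1 < v (p 0) ∨ 1 < v (p 1)
  · obtain ⟨-, i, -, hg1, -⟩ := asymptote h.injective (smoothing_eq_zero_or a b) hv he.le hp hf
    exact hg1 (hg 1)
  have hp' : ∀ k, v (p k) ≤ 1 := by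
    push Not at hp
    intro k
    fin_cases k
    · exact hp.1
    · exact hp.2
  have hint : ∀ g : Poly, v (aeval p g) ≤ 1 := fun g => by
    simpa using valuation_aeval_le hv le_rfl hp' g le_rfl
  have hsmall : ∀ g : Poly, v (e * aeval p g) < 1 := fun g => by
    rw [map_mul]
    exact mul_lt_one_of_lt_of_le he (hint g)
  -- A finite point of the curve is infinitely near some line; if it were near only one, the
  -- derivative in `y` would be dominated by a cofactor of value 1.
  obtain ⟨i, hi⟩ : ∃ i, v (aeval p (lineForm (a i) (b i))) < 1 := by
    by_contra! hcon
    have h1 : v (aeval p (arrangement a b)) = 1 := by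
      rw [arrangement, map_prod, map_prod]
      exact Finset.prod_eq_one fun k _ => le_antisymm (hint _) (hcon k)
    rw [eq_neg_of_add_eq_zero_left hf, Valuation.map_neg] at h1
    exact (hsmall _).ne h1
  obtain ⟨j, hji, hj⟩ : ∃ j, j ≠ i ∧ v (aeval p (lineForm (a j) (b j))) < 1 := by
    by_contra! hcon
    have h1 : v (aeval p (cofactor a b i)) = 1 := by
      rw [cofactor, map_prod, map_prod]
      exact Finset.prod_eq_one fun k hk =>
        le_antisymm (hint _) (hcon k (Finset.ne_of_mem_erase hk))
    have h2 : aeval p (cofactor a b i) = -(aeval p (lineForm (a i) (b i)) *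
        aeval p (pderiv 1 (cofactor a b i)) + e * aeval p (pderiv 1 (smoothing a b))) := by
      have := hg 1
      simp only [gradAt, arrangement_eq_mul_cofactor a b i, pderiv_mul, pderiv_one_lineForm,
        map_add, map_mul, map_one] at this
      linear_combination this
    rw [h2, Valuation.map_neg] at h1
    refine (v.map_add_lt ?_ (hsmall _)).ne h1
    rw [map_mul]
    exact mul_lt_one_of_lt_of_le hi (hint _)
  have hA : v (aeval p (cofactor₂ a b i j)) = 1 := by
    rw [cofactor₂, map_prod, map_prod]
    refine Finset.prod_eq_one fun k hk => ?_
    simp only [Finset.mem_compl, Finset.mem_insert, Finset.mem_singleton, not_or] at hk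
    exact valuation_third_line h hv (Ne.symm hji) (Ne.symm hk.1) (Ne.symm hk.2) hi hj
  have hH : v (aeval p (smoothing a b)) = 1 := by
    obtain ⟨B, C, hBC⟩ := exists_smoothing_eq a b (Ne.symm hji)
    have hBC' := congrArg (aeval p) hBC
    rw [map_add, map_add, map_mul, map_mul, add_assoc] at hBC'
    rw [hBC', Valuation.map_add_eq_of_lt_left, hA]
    rw [hA]
    refine v.map_add_lt ?_ ?_ <;> rw [map_mul]
    · exact mul_lt_one_of_lt_of_le hi (hint _)
    · exact mul_lt_one_of_lt_of_le hj (hint _)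
  -- Differentiate along `(1, a i)`: this kills the form of line `i` and gives `a i - a j` on that
  -- of line `j`, so the vanishing gradient bounds the form of line `i` by `e`.
  have key : ∀ i j : Fin d, i ≠ j → v (aeval p (cofactor₂ a b i j)) = 1 →
      v (aeval p (lineForm (a j) (b j))) < 1 → v (aeval p (lineForm (a i) (b i))) ≤ v e := by
    intro i j hij hA hj
    set l := aeval p (lineForm (a i) (b i)) with hl
    set D : Poly → K := fun g =>
      aeval p (pderiv 0 g) + algebraMap ℝ K (a i) * aeval p (pderiv 1 g) with hD
    have hDint : ∀ g, v (D g) ≤ 1 := fun g =>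
      (v.map_add _ _).trans (max_le (hint _) (by rw [map_mul]; exact mul_le_one' (hv _) (hint _)))
    have h1 : l * (algebraMap ℝ K (a i - a j) * aeval p (cofactor₂ a b i j) +
        aeval p (lineForm (a j) (b j)) * D (cofactor₂ a b i j)) = -(e * D (smoothing a b)) := by
      have h0 := hg 0
      have h1 := hg 1
      simp only [gradAt, arrangement_eq_mul_cofactor₂ a b hij, pderiv_mul, pderiv_one_lineForm,
        pderiv_zero_lineForm, map_add, map_mul, map_one, algHom_C, map_neg, ← hl] at h0 h1
      simp only [hD, map_sub]
      linear_combination h0 + algebraMap ℝ K (a i) * h1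
    have h2 : v (l * (algebraMap ℝ K (a i - a j) * aeval p (cofactor₂ a b i j) +
        aeval p (lineForm (a j) (b j)) * D (cofactor₂ a b i j))) = v l := by
      have h3 : v (algebraMap ℝ K (a i - a j) * aeval p (cofactor₂ a b i j)) = 1 := by
        rw [map_mul, hA, mul_one, valuation_real hv (sub_ne_zero.2 (h.not_parallel i j hij))]
      rw [map_mul, Valuation.map_add_eq_of_lt_left, h3, mul_one]
      rw [h3, map_mul]
      exact mul_lt_one_of_lt_of_le hj (hDint _)
    rw [← h2, h1, Valuation.map_neg, map_mul]
    exact mul_le_of_le_one_right' (hDint _)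
  have hli := key i j (Ne.symm hji) hA hj
  have hlj := key j i hji (by rwa [cofactor₂, Finset.pair_comm]) hi
  -- The equation makes the product of the two small forms comparable to `e`, whereas each factor is
  -- at most of the order of `e`.
  have h1 : v e ≤ v e * v e := by
    calc v e = v (aeval p (arrangement a b)) := by
          rw [eq_neg_of_add_eq_zero_left hf, Valuation.map_neg, map_mul, hH, mul_one]
      _ = v (aeval p (lineForm (a i) (b i))) * v (aeval p (lineForm (a j) (b j))) := by
          rw [arrangement_eq_mul_cofactor₂ a b (Ne.symm hji), map_mul, map_mul, map_mul, map_mul,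
            hA, mul_one]
      _ ≤ v e * v e := mul_le_mul' hli hlj
  have he1 : 0 < v e := zero_lt_iff.2 (v.ne_zero_iff.2 he0)
  exact absurd h1 (not_le.2 (mul_lt_of_lt_one_left he1 he))

end valuation

/-- All but finitely many curves of the pencil have no singular real point. -/
theorem finite_setOf_singular (h : StronglyGeneric a b) :
    {ε : ℝ | ∃ p ∈ zeroLocus (arrangement a b + C ε * smoothing a b),
      grad (arrangement a b + C ε * smoothing a b) p = 0}.Finite := by
  by_contra hinf
  let S : Set (Option (Fin 2) → ℝ) :=
    {s | (s ∘ some) ∈ zeroLocus (arrangement a b + C (s none) * smoothing a b) ∧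
      grad (arrangement a b + C (s none) * smoothing a b) (s ∘ some) = 0}
  have hS : ((fun s : Option (Fin 2) → ℝ => s none) '' S).Infinite := by
    refine Set.Infinite.mono ?_ hinf
    rintro ε ⟨p, hp⟩
    exact ⟨fun o => o.elim ε p, hp, rfl⟩
  obtain ⟨K, _, _, P, hP0, -, htr⟩ := exists_generic_point S none hS
  have hren : ∀ (g : Poly) (s : Option (Fin 2) → ℝ),
      eval s (rename some g) = eval (s ∘ some) g := fun g s => eval_rename _ _ _
  have hf : aeval (P ∘ some) (arrangement a b) +
      P none * aeval (P ∘ some) (smoothing a b) = 0 := by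
    have := hP0 (rename some (arrangement a b) + X none * rename some (smoothing a b))
      fun s hs => by
        have := hs.1
        simpa [zeroLocus, hren] using this
    simpa [aeval_rename] using this
  have hg : ∀ k, gradAt (arrangement a b) (smoothing a b) (P none) (P ∘ some) k = 0 := by
    intro k
    have := hP0 (rename some (pderiv k (arrangement a b)) +
      X none * rename some (pderiv k (smoothing a b)))
      fun s hs => by
        have := congrFun hs.2 k
        simpa [grad, hren] using this
    simpa [aeval_rename, gradAt] using this
  have hne : P none ≠ 0 := fun h0 => htr (h0 ▸ isAlgebraic_zero)
  -- Making the inverse of the parameter infinite makes the parameter infinitesimal.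
  obtain ⟨O, hv, hO⟩ := exists_valuation_one_lt (τ := (P none)⁻¹)
    (fun hal => htr (IsAlgebraic.inv_iff.1 hal))
  refine not_singular_of_valuation_lt_one h hv ?_ hne hf hg
  rw [map_inv₀] at hO
  exact (one_lt_inv₀ (zero_lt_iff.2 (by simpa using hne))).1 hO

end curve

/-! ### Squarefreeness and degree of the resolution. -/

theorem degreeOf_aeval_X_eq_zero {i j : Fin 2} (hij : i ≠ j) (A : Polynomial ℝ) :
    degreeOf j (Polynomial.aeval (X i : Poly) A) = 0 := by
  rw [Polynomial.aeval_eq_sum_range]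
  refine Nat.le_zero.1 ((degreeOf_sum_le _ _ _).trans (Finset.sup_le fun n _ => ?_))
  rw [smul_eq_C_mul]
  refine (degreeOf_C_mul_le _ _ _).trans ((degreeOf_pow_le _ _ _).trans ?_)
  rw [degreeOf_X_of_ne hij.symm, mul_zero]

theorem degreeOf_eq_zero_of_dvd_aeval_X {i j : Fin 2} (hij : i ≠ j) {A : Polynomial ℝ}
    (hA : A ≠ 0) {g : Poly} (hg : g ∣ Polynomial.aeval (X i : Poly) A) : degreeOf j g = 0 := by
  have h0 : Polynomial.aeval (X i : Poly) A ≠ 0 := by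
    intro h
    have := congrArg (aeval fun _ => (Polynomial.X : Polynomial ℝ)) h
    rw [← Polynomial.aeval_algHom_apply, aeval_X, map_zero, Polynomial.aeval_X_left_apply] at this
    exact hA this
  obtain ⟨k, hk⟩ := hg
  have h1 := degreeOf_aeval_X_eq_zero hij A
  rw [hk] at h0 h1
  rw [degreeOf_mul_eq (left_ne_zero_of_mul h0) (right_ne_zero_of_mul h0)] at h1
  omega

section curve

variable {d : ℕ} {a b : Fin d → ℝ} {H : Poly}

/-- The generic point of a multiple component would be singular on the curve, and some coordinate of
it is transcendental; but the gradient does not vanish at infinite points. -/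
theorem squarefree_resolution (ha : Function.Injective a) (hH : H = 0 ∨ H.totalDegree + 2 ≤ d)
    (ε : ℝ) : Squarefree (arrangement a b + C ε * H) := by
  rw [squarefree_iff_irreducible_sq_not_dvd_of_exists_irreducible
    ⟨X 0, X_prime.irreducible⟩]
  rintro g hgirr ⟨h, hgh⟩
  have hgp : Prime g := hgirr.prime
  have : (Ideal.span {g}).IsPrime := (Ideal.span_singleton_prime hgp.ne_zero).2 hgp
  let R := Poly ⧸ Ideal.span {g}
  let K := FractionRing R
  let φ : Poly →ₐ[ℝ] K := (IsScalarTower.toAlgHom ℝ R K).comp (Ideal.Quotient.mkₐ ℝ _)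
  let p : Fin 2 → K := fun i => φ (X i)
  have hφ : ∀ q, aeval p q = φ q := fun q => by
    exact (DFunLike.congr_fun (aeval_unique φ) q).symm
  have hker : ∀ q, φ q = 0 ↔ g ∣ q := by
    intro q
    rw [← Ideal.mem_span_singleton, ← Ideal.Quotient.eq_zero_iff_mem]
    exact (IsFractionRing.injective R K).eq_iff' (map_zero _)
  have hg0 : aeval p g = 0 := by rw [hφ, hker]
  have htr : ∃ i, Transcendental ℝ (p i) := by
    by_contra! hcon
    -- If coordinate `i` is algebraic, `g` divides a nonzero polynomial in that variable alone and
    -- so does not involve the other one.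
    have key : ∀ i j : Fin 2, i ≠ j → degreeOf j g = 0 := by
      intro i j hij
      obtain ⟨A, hA, hA0⟩ := not_not.1 (hcon i)
      refine degreeOf_eq_zero_of_dvd_aeval_X hij hA ((hker _).1 ?_)
      rw [← Polynomial.aeval_algHom_apply]
      exact hA0
    have htd : g.totalDegree = 0 := by
      refine Nat.le_zero.1 (Finset.sup_le fun m hm => ?_)
      have h1 := (degreeOf_le_iff.1 (key 0 1 (by decide)).le) m hm
      have h2 := (degreeOf_le_iff.1 (key 1 0 (by decide)).le) m hm
      rw [Finsupp.sum_fintype _ _ fun _ => rfl, Fin.sum_univ_two]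
      omega
    rw [totalDegree_eq_zero_iff_eq_C] at htd
    refine hgirr.not_isUnit ?_
    rw [htd]
    refine IsUnit.map C (isUnit_iff_ne_zero.2 ?_)
    intro h0
    rw [h0, map_zero] at htd
    exact hgp.ne_zero htd
  obtain ⟨i, hi⟩ := htr
  obtain ⟨O, hv, hO⟩ := exists_valuation_one_lt hi
  have hp : 1 < O.valuation (p 0) ∨ 1 < O.valuation (p 1) := by
    fin_cases i
    · exact Or.inl hO
    · exact Or.inr hO
  have hf : aeval p (arrangement a b) + algebraMap ℝ K ε * aeval p H = 0 := by
    have := congrArg (aeval p) hgh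
    simpa [hg0] using this
  obtain ⟨-, j, -, hg1, -⟩ := asymptote ha hH hv (hv ε) hp hf
  rw [gradAt_algebraMap, hgh] at hg1
  refine hg1 ?_
  simp [hg0]

theorem totalDegree_lineForm (a b : ℝ) : (lineForm a b).totalDegree = 1 := by
  refine le_antisymm (totalDegree_lineForm_le a b) (Nat.one_le_iff_ne_zero.2 fun h => ?_)
  have h1 := totalDegree_pderiv_le 1 (lineForm a b)
  rw [totalDegree_eq_zero_iff_eq_C] at h
  have h2 := pderiv_one_lineForm a b
  rw [h, pderiv_C] at h2
  exact zero_ne_one h2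

theorem lineForm_ne_zero (a b : ℝ) : lineForm a b ≠ 0 := by
  intro h
  have := totalDegree_lineForm a b
  rw [h, totalDegree_zero] at this
  exact zero_ne_one this

theorem totalDegree_arrangement (a b : Fin d → ℝ) : (arrangement a b).totalDegree = d := by
  have key : ∀ s : Finset (Fin d), (∏ k ∈ s, lineForm (a k) (b k)).totalDegree = s.card := by
    intro s
    induction s using Finset.induction_on with
    | empty => simp
    | insert i s hi ih =>
      rw [Finset.prod_insert hi, totalDegree_mul_of_isDomain (lineForm_ne_zero _ _)
        (Finset.prod_ne_zero_iff.2 fun k _ => lineForm_ne_zero _ _), ih, totalDegree_lineForm,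
        Finset.card_insert_of_notMem hi, add_comm]
  simpa [arrangement] using key Finset.univ

theorem totalDegree_resolution (hH : H = 0 ∨ H.totalDegree + 2 ≤ d) (ε : ℝ) :
    (arrangement a b + C ε * H).totalDegree = d := by
  rcases hH with rfl | hH
  · simp [totalDegree_arrangement]
  · rw [totalDegree_add_eq_left_of_totalDegree_lt, totalDegree_arrangement]
    rw [totalDegree_arrangement]
    have := totalDegree_mul (C ε) H
    rw [totalDegree_C] at this
    omega

theorem isCircleFreeCurve_resolution (ha : Function.Injective a)
    (hH : H = 0 ∨ H.totalDegree + 2 ≤ d) (ε : ℝ) :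
    IsCircleFreeCurve d (arrangement a b + C ε * H) where
  squarefree := squarefree_resolution ha hH ε
  degree_eq := totalDegree_resolution hH ε
  no_circle c _ hr := not_circlePoly_dvd ha hH ε c hr

end curve

/-! ### Persistence of zeros and the rescaled equations at the nodes. -/

/-- Zeros of a family of maps persist at points where the derivative along the fibre is onto; the
derivative is tested on lines, along which the map is assumed quadratic. -/
theorem eventually_exists_zero {E F : Type} [NormedAddCommGroup E] [NormedSpace ℝ E]
    [CompleteSpace E] [NormedAddCommGroup F] [NormedSpace ℝ F] [CompleteSpace F]
    {Φ : ℝ × E → F} (hΦ : ContDiff ℝ 1 Φ) {z₀ : E}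
    (hsurj : ∀ τ : F, ∃ (δ : E) (c : F), ∀ t : ℝ, Φ (0, z₀ + t • δ) = t • τ + t ^ 2 • c)
    {V : Set (ℝ × E)} (hV : V ∈ 𝓝 ((0 : ℝ), z₀)) :
    ∀ᶠ s in 𝓝 (0 : ℝ), ∃ z, (s, z) ∈ V ∧ Φ (s, z) = 0 := by
  have hzero : Φ (0, z₀) = 0 := by
    obtain ⟨δ, c, h⟩ := hsurj 0
    simpa using h 0
  have hd := (hΦ.contDiffAt (x := ((0 : ℝ), z₀))).hasStrictFDerivAt one_ne_zero
  set Φ' := fderiv ℝ Φ ((0 : ℝ), z₀)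
  have hfib : ∀ τ : F, ∃ δ : E, Φ' (0, δ) = τ := by
    intro τ
    obtain ⟨δ, c, h⟩ := hsurj τ
    refine ⟨δ, ?_⟩
    have hline : HasDerivAt (fun t : ℝ => ((0 : ℝ), z₀ + t • δ)) ((0 : ℝ), δ) 0 := by
      refine (hasDerivAt_const _ _).prodMk ?_
      simpa using ((hasDerivAt_id (0 : ℝ)).smul_const δ).const_add z₀
    have h1 : HasDerivAt (fun t : ℝ => Φ (0, z₀ + t • δ)) (Φ' (0, δ)) 0 := by
      refine HasFDerivAt.comp_hasDerivAt (0 : ℝ) (l := Φ) ?_ hline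
      simpa using hd.hasFDerivAt
    have h2 : HasDerivAt (fun t : ℝ => Φ (0, z₀ + t • δ)) τ 0 := by
      have h3 := ((hasDerivAt_id (0 : ℝ)).smul_const τ).add
        (((hasDerivAt_id (0 : ℝ)).pow 2).smul_const c)
      have h4 : (fun t : ℝ => Φ (0, z₀ + t • δ)) = fun t => t • τ + t ^ 2 • c := funext h
      rw [h4]
      exact h3.congr_deriv (by simp)
    exact h1.unique h2
  -- Adjoining the parameter makes the whole derivative onto, so the augmented map is open at the
  -- point and its image of `V` contains all `(s, 0)` with `s` small.
  have hd2 : HasStrictFDerivAt (fun x : ℝ × E => (x.1, Φ x))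
      ((ContinuousLinearMap.fst ℝ ℝ E).prod Φ') ((0 : ℝ), z₀) :=
    hasStrictFDerivAt_fst.prodMk hd
  have hrange : ((ContinuousLinearMap.fst ℝ ℝ E).prod Φ').range = ⊤ := by
    rw [LinearMap.range_eq_top]
    rintro ⟨s, τ⟩
    obtain ⟨δ, hδ⟩ := hfib (τ - Φ' (s, 0))
    refine ⟨(s, δ), Prod.ext rfl ?_⟩
    have : ((s, δ) : ℝ × E) = (s, 0) + (0, δ) := by simp
    change Φ' (s, δ) = τ
    rw [this, map_add, hδ]
    abel
  have hmap := hd2.map_nhds_eq_of_surj hrange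
  have himg : (fun x : ℝ × E => (x.1, Φ x)) '' V ∈ 𝓝 ((0 : ℝ), (0 : F)) := by
    rw [← hzero, ← hmap]
    exact Filter.image_mem_map hV
  have hcont : Filter.Tendsto (fun s : ℝ => (s, (0 : F))) (𝓝 0) (𝓝 (0, 0)) :=
    (Continuous.prodMk_left (0 : F)).tendsto 0
  filter_upwards [hcont himg] with s hs
  obtain ⟨⟨s', z⟩, hz, heq⟩ := hs
  obtain ⟨rfl, h0⟩ := Prod.mk.inj heq
  exact ⟨z, hz, h0⟩

theorem contDiff_eval (g : Poly) : ContDiff ℝ 1 fun p : Plane => eval p g := by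
  induction g using MvPolynomial.induction_on with
  | C a => simpa using contDiff_const
  | add p q hp hq => simpa using hp.add hq
  | mul_X p i hp => simpa using hp.mul (contDiff_apply ℝ ℝ i)

/-- A node of a curve: the crossing at `u` of lines of slopes `a₁` and `a₂`, the local equation
being the product of the two line forms and of `A`, perturbed by multiples of `H`. -/
structure Node where
  a₁ : ℝ
  a₂ : ℝ
  u : Plane
  A : Poly
  H : Poly
  ne : a₁ ≠ a₂
  ne_zero : eval u A ≠ 0
  eval_eq : eval u H = eval u A

namespace Node

/-- The perturbed equation. -/
noncomputable def poly (n : Node) (ε : ℝ) : Poly :=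
  lineForm n.a₁ (n.u 1 - n.a₁ * n.u 0) * lineForm n.a₂ (n.u 1 - n.a₂ * n.u 0) * n.A + C ε * n.H

/-- The vector on which the linear parts of the two line forms take given values. -/
noncomputable def vec (n : Node) (x : ℝ × ℝ) : Plane :=
  ![(x.1 - x.2) / (n.a₂ - n.a₁), x.1 + n.a₁ * ((x.1 - x.2) / (n.a₂ - n.a₁))]

/-- The point with given coordinates at scale `s`. -/
noncomputable def pt (n : Node) (s : ℝ) (x : ℝ × ℝ) : Plane := n.u + s • n.vec x

/-- The perturbed equation with parameter `s ^ 2`, rescaled by `s`. -/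
noncomputable def value (n : Node) (s : ℝ) (x : ℝ × ℝ) : ℝ :=
  x.1 * x.2 * eval (n.pt s x) n.A + eval (n.pt s x) n.H

/-- The rescaled partial derivative in the first coordinate. -/
noncomputable def slope₀ (n : Node) (s : ℝ) (x : ℝ × ℝ) : ℝ :=
  -(n.a₁ * x.2 + n.a₂ * x.1) * eval (n.pt s x) n.A +
    s * (x.1 * x.2 * eval (n.pt s x) (pderiv 0 n.A) + eval (n.pt s x) (pderiv 0 n.H))

/-- The rescaled partial derivative in the second coordinate. -/
noncomputable def slope₁ (n : Node) (s : ℝ) (x : ℝ × ℝ) : ℝ :=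
  (x.1 + x.2) * eval (n.pt s x) n.A +
    s * (x.1 * x.2 * eval (n.pt s x) (pderiv 1 n.A) + eval (n.pt s x) (pderiv 1 n.H))

theorem pt_apply_zero (n : Node) (s : ℝ) (x : ℝ × ℝ) :
    n.pt s x 0 = n.u 0 + s * ((x.1 - x.2) / (n.a₂ - n.a₁)) := rfl

theorem pt_apply_one (n : Node) (s : ℝ) (x : ℝ × ℝ) :
    n.pt s x 1 = n.u 1 + s * (x.1 + n.a₁ * ((x.1 - x.2) / (n.a₂ - n.a₁))) := rfl

theorem eval_line₁ (n : Node) (s : ℝ) (x : ℝ × ℝ) :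
    eval (n.pt s x) (lineForm n.a₁ (n.u 1 - n.a₁ * n.u 0)) = s * x.1 := by
  rw [eval_lineForm, pt_apply_zero, pt_apply_one]
  ring

theorem eval_line₂ (n : Node) (s : ℝ) (x : ℝ × ℝ) :
    eval (n.pt s x) (lineForm n.a₂ (n.u 1 - n.a₂ * n.u 0)) = s * x.2 := by
  have : n.a₂ - n.a₁ ≠ 0 := sub_ne_zero.2 n.ne.symm
  rw [eval_lineForm, pt_apply_zero, pt_apply_one]
  field_simp
  ring

theorem eval_poly (n : Node) (s : ℝ) (x : ℝ × ℝ) :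
    eval (n.pt s x) (n.poly (s ^ 2)) = s ^ 2 * n.value s x := by
  simp only [poly, map_add, map_mul, eval_line₁, eval_line₂, eval_C, value]
  ring

theorem eval_pderiv_zero_poly (n : Node) (s : ℝ) (x : ℝ × ℝ) :
    eval (n.pt s x) (pderiv 0 (n.poly (s ^ 2))) = s * n.slope₀ s x := by
  simp only [poly, map_add, map_mul, eval_line₁, eval_line₂, eval_C, slope₀, pderiv_mul,
    pderiv_zero_lineForm, pderiv_C, map_zero]
  ring

theorem eval_pderiv_one_poly (n : Node) (s : ℝ) (x : ℝ × ℝ) :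
    eval (n.pt s x) (pderiv 1 (n.poly (s ^ 2))) = s * n.slope₁ s x := by
  simp only [poly, map_add, map_mul, eval_line₁, eval_line₂, eval_C, slope₁, pderiv_mul,
    pderiv_one_lineForm, pderiv_C, map_one, map_zero]
  ring

theorem pt_zero (n : Node) (x : ℝ × ℝ) : n.pt 0 x = n.u := by simp [pt]

theorem value_zero (n : Node) (x : ℝ × ℝ) : n.value 0 x = eval n.u n.A * (x.1 * x.2 + 1) := by
  rw [value, pt_zero, n.eval_eq]; ring

theorem slope₀_zero (n : Node) (x : ℝ × ℝ) :
    n.slope₀ 0 x = -(eval n.u n.A * (n.a₁ * x.2 + n.a₂ * x.1)) := by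
  rw [slope₀, pt_zero]; ring

theorem slope₁_zero (n : Node) (x : ℝ × ℝ) :
    n.slope₁ 0 x = eval n.u n.A * (x.1 + x.2) := by
  rw [slope₁, pt_zero]; ring

section contDiff

variable {E : Type} [NormedAddCommGroup E] [NormedSpace ℝ E] {s : E → ℝ} {x : E → ℝ × ℝ}

theorem contDiff_vec (n : Node) (hx : ContDiff ℝ 1 x) (k : Fin 2) :
    ContDiff ℝ 1 fun e => n.vec (x e) k := by
  fin_cases k
  · exact (hx.fst.sub hx.snd).div_const _
  · exact hx.fst.add (contDiff_const.mul ((hx.fst.sub hx.snd).div_const _))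

theorem contDiff_eval_pt (n : Node) (hs : ContDiff ℝ 1 s) (hx : ContDiff ℝ 1 x) (g : Poly) :
    ContDiff ℝ 1 fun e => eval (n.pt (s e) (x e)) g := by
  refine (contDiff_eval g).comp (contDiff_pi.2 fun k => ?_)
  exact contDiff_const.add (hs.mul (n.contDiff_vec hx k))

theorem contDiff_value (n : Node) (hs : ContDiff ℝ 1 s) (hx : ContDiff ℝ 1 x) :
    ContDiff ℝ 1 fun e => n.value (s e) (x e) :=
  ((hx.fst.mul hx.snd).mul (n.contDiff_eval_pt hs hx _)).add (n.contDiff_eval_pt hs hx _)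

theorem contDiff_slope₀ (n : Node) (hs : ContDiff ℝ 1 s) (hx : ContDiff ℝ 1 x) :
    ContDiff ℝ 1 fun e => n.slope₀ (s e) (x e) :=
  (((contDiff_const.mul hx.snd).add (contDiff_const.mul hx.fst)).neg.mul
    (n.contDiff_eval_pt hs hx _)).add (hs.mul
    (((hx.fst.mul hx.snd).mul (n.contDiff_eval_pt hs hx _)).add (n.contDiff_eval_pt hs hx _)))

theorem contDiff_slope₁ (n : Node) (hs : ContDiff ℝ 1 s) (hx : ContDiff ℝ 1 x) :
    ContDiff ℝ 1 fun e => n.slope₁ (s e) (x e) :=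
  ((hx.fst.add hx.snd).mul (n.contDiff_eval_pt hs hx _)).add (hs.mul
    (((hx.fst.mul hx.snd).mul (n.contDiff_eval_pt hs hx _)).add (n.contDiff_eval_pt hs hx _)))

end contDiff

/-- The direction joining points near two nodes, suitably rescaled. -/
noncomputable def dir (m n : Node) (w : Plane) (κ : ℝ × ℝ) (z : ℝ × ((ℝ × ℝ) × (ℝ × ℝ))) :
    Plane :=
  fun k => w k + (κ.1 + κ.2 * z.1) * (n.vec z.2.2 k - m.vec z.2.1 k)

/-- The equations of the diameters with endpoints near two given nodes. -/
noncomputable def system (m n : Node) (w : Plane) (κ : ℝ × ℝ) (z : ℝ × ((ℝ × ℝ) × (ℝ × ℝ))) :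
    (ℝ × ℝ) × (ℝ × ℝ) :=
  ((m.value z.1 z.2.1, n.value z.1 z.2.2),
    (dir m n w κ z 0 * m.slope₁ z.1 z.2.1 - dir m n w κ z 1 * m.slope₀ z.1 z.2.1,
      dir m n w κ z 0 * n.slope₁ z.1 z.2.2 - dir m n w κ z 1 * n.slope₀ z.1 z.2.2))

theorem contDiff_system (m n : Node) (w : Plane) (κ : ℝ × ℝ) :
    ContDiff ℝ 1 (system m n w κ) := by
  have hs : ContDiff ℝ 1 fun z : ℝ × ((ℝ × ℝ) × (ℝ × ℝ)) => z.1 := contDiff_fst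
  have hx : ContDiff ℝ 1 fun z : ℝ × ((ℝ × ℝ) × (ℝ × ℝ)) => z.2.1 := contDiff_snd.fst
  have hy : ContDiff ℝ 1 fun z : ℝ × ((ℝ × ℝ) × (ℝ × ℝ)) => z.2.2 := contDiff_snd.snd
  have hdir : ∀ k, ContDiff ℝ 1 fun z => dir m n w κ z k := fun k =>
    contDiff_const.add ((contDiff_const.add (contDiff_const.mul hs)).mul
      ((n.contDiff_vec hy k).sub (m.contDiff_vec hx k)))
  exact ((m.contDiff_value hs hx).prodMk (n.contDiff_value hs hy)).prodMk
    ((((hdir 0).mul (m.contDiff_slope₁ hs hx)).sub ((hdir 1).mul (m.contDiff_slope₀ hs hx))).prodMk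
      (((hdir 0).mul (n.contDiff_slope₁ hs hy)).sub ((hdir 1).mul (n.contDiff_slope₀ hs hy))))

/-- The points near the node on the side of the branch that lies in the narrow sector where the
first line form is positive. -/
def Side (n : Node) (p : Plane) : Prop :=
  |p 0 - n.u 0| < 1 / 2 ∧ 0 < (p 0 - n.u 0) * (n.a₂ - n.a₁)

/-- The points near the node on the other side. -/
def OppositeSide (n : Node) (p : Plane) : Prop :=
  |p 0 - n.u 0| < 1 / 2 ∧ (p 0 - n.u 0) * (n.a₂ - n.a₁) < 0

theorem eventually_abs_lt (n : Node) {E : Type} [NormedAddCommGroup E] [NormedSpace ℝ E]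
    {x : E → ℝ × ℝ} (hx : ContDiff ℝ 1 x) (z₀ : E) :
    ∀ᶠ z : ℝ × E in 𝓝 (0, z₀), |n.pt z.1 (x z.2) 0 - n.u 0| < 1 / 2 := by
  have h1 : Continuous fun z : ℝ × E => |n.pt z.1 (x z.2) 0 - n.u 0| := by
    have := (n.contDiff_eval_pt (E := ℝ × E) contDiff_fst (hx.comp contDiff_snd) (X 0)).continuous
    simp only [eval_X] at this
    exact (this.sub continuous_const).abs
  refine h1.continuousAt.eventually_lt_const ?_
  simp [pt_zero]

theorem pt_sub_mul (n : Node) (s : ℝ) (x : ℝ × ℝ) :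
    (n.pt s x 0 - n.u 0) * (n.a₂ - n.a₁) = s * (x.1 - x.2) := by
  have : n.a₂ - n.a₁ ≠ 0 := sub_ne_zero.2 n.ne.symm
  simp [pt, vec]
  field_simp

/-- The segment `pq` satisfies the equations of a diameter of the curve with equation `f` at `p` and
`g` at `q`. -/
structure IsCandidate (f g : Poly) (p q : Plane) : Prop where
  left : eval p f = 0
  right : eval q g = 0
  perp_left : (q 0 - p 0) * eval p (pderiv 1 f) = (q 1 - p 1) * eval p (pderiv 0 f)
  perp_right : (q 0 - p 0) * eval q (pderiv 1 g) = (q 1 - p 1) * eval q (pderiv 0 g)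

theorem isCandidate_of_system_eq_zero {m n : Node} {w : Plane} {κ : ℝ × ℝ} {s μ : ℝ}
    {z : (ℝ × ℝ) × (ℝ × ℝ)} (h : system m n w κ (s, z) = 0)
    (hμ : ∀ k, n.pt s z.2 k - m.pt s z.1 k = μ * dir m n w κ (s, z) k) :
    IsCandidate (m.poly (s ^ 2)) (n.poly (s ^ 2)) (m.pt s z.1) (n.pt s z.2) := by
  simp only [system, Prod.mk_eq_zero] at h
  obtain ⟨⟨h1, h2⟩, h3, h4⟩ := h
  refine ⟨?_, ?_, ?_, ?_⟩
  · rw [eval_poly, h1, mul_zero]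
  · rw [eval_poly, h2, mul_zero]
  · rw [hμ, hμ, eval_pderiv_zero_poly, eval_pderiv_one_poly]
    linear_combination μ * s * h3
  · rw [hμ, hμ, eval_pderiv_zero_poly, eval_pderiv_one_poly]
    linear_combination μ * s * h4

/-- At each of two nodes the branch has a point whose normal is parallel to the line through the
nodes, and these points extend to a diameter. -/
theorem eventually_exists_of_ne (m n : Node)
    (hm : 0 < (n.u 0 - m.u 0 + m.a₁ * (n.u 1 - m.u 1)) * (n.u 0 - m.u 0 + m.a₂ * (n.u 1 - m.u 1)))
    (hn : 0 < (n.u 0 - m.u 0 + n.a₁ * (n.u 1 - m.u 1)) * (n.u 0 - m.u 0 + n.a₂ * (n.u 1 - m.u 1))) :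
    ∀ᶠ s in 𝓝[>] (0 : ℝ), ∃ p q, m.Side p ∧ n.Side q ∧
      IsCandidate (m.poly (s ^ 2)) (n.poly (s ^ 2)) p q := by
  -- `P₁` and `P₂` are the products of the joining direction with `(1, a₁)` and `(1, a₂)`. On `X Y =
  -- -1` the normal is parallel to that direction when `X P₂ + Y P₁ = 0`, that is `X² = P₁ / P₂`;
  -- hence the sign condition. The last clause solves the linearized equations.
  have key : ∀ P₁ P₂ c : ℝ, c ≠ 0 → 0 < P₁ * P₂ → ∃ x : ℝ × ℝ, 0 < x.1 - x.2 ∧ x.1 * x.2 = -1 ∧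
      x.1 * P₂ + x.2 * P₁ = 0 ∧ ∀ τ₁ τ₂ : ℝ, ∃ y : ℝ × ℝ, c * (x.1 * y.2 + x.2 * y.1) = τ₁ ∧
        c * (y.1 * P₂ + y.2 * P₁) = τ₂ := by
    intro P₁ P₂ c hc hP
    have hP₂ : P₂ ≠ 0 := right_ne_zero_of_mul hP.ne'
    have hq : 0 < P₁ / P₂ := by
      have : P₁ / P₂ = P₁ * P₂ / P₂ ^ 2 := by field_simp
      rw [this]
      positivity
    set r := √(P₁ / P₂) with hr
    have hr0 : 0 < r := Real.sqrt_pos.2 hq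
    have hr2 : P₁ = r ^ 2 * P₂ := by
      rw [hr, Real.sq_sqrt hq.le]
      field_simp
    refine ⟨(r, -r⁻¹), ?_, ?_, ?_, fun τ₁ τ₂ => ⟨((τ₂ / (c * P₂) - r * (τ₁ / c)) / 2,
      (τ₂ / (c * P₂) + r * (τ₁ / c)) / (2 * r ^ 2)), ?_, ?_⟩⟩
    · have := inv_pos.2 hr0
      simp only
      linarith
    · field_simp
    · simp only [hr2]
      field_simp
      ring
    · field_simp
      ring
    · simp only [hr2]
      field_simp
      ring
  obtain ⟨x, hx1, hx2, hx3, hx⟩ := key _ _ _ m.ne_zero hm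
  obtain ⟨y, hy1, hy2, hy3, hy⟩ := key _ _ _ n.ne_zero hn
  have hV : ∀ᶠ z : ℝ × ((ℝ × ℝ) × (ℝ × ℝ)) in 𝓝 (0, (x, y)),
      (|m.pt z.1 z.2.1 0 - m.u 0| < 1 / 2 ∧ |n.pt z.1 z.2.2 0 - n.u 0| < 1 / 2) ∧
      (0 < z.2.1.1 - z.2.1.2 ∧ 0 < z.2.2.1 - z.2.2.2) := by
    refine ((m.eventually_abs_lt contDiff_fst _).and (n.eventually_abs_lt contDiff_snd _)).and ?_
    refine Filter.Eventually.and ?_ ?_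
    · exact (Continuous.tendsto (f := fun z : ℝ × ((ℝ × ℝ) × (ℝ × ℝ)) => z.2.1.1 - z.2.1.2)
        (by fun_prop) _).eventually_const_lt hx1
    · exact (Continuous.tendsto (f := fun z : ℝ × ((ℝ × ℝ) × (ℝ × ℝ)) => z.2.2.1 - z.2.2.2)
        (by fun_prop) _).eventually_const_lt hy1
  -- With `κ = (0, 1)`, `dir` is the actual displacement, tending to the difference of the vertices.
  have hsol := eventually_exists_zero (contDiff_system m n (n.u - m.u) (0, 1)) (z₀ := (x, y))
    (fun τ => by
      obtain ⟨δ, hδ1, hδ2⟩ := hx τ.1.1 τ.2.1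
      obtain ⟨γ, hγ1, hγ2⟩ := hy τ.1.2 τ.2.2
      refine ⟨(δ, γ), ((eval m.u m.A * (δ.1 * δ.2), eval n.u n.A * (γ.1 * γ.2)), 0), fun t => ?_⟩
      simp only [system, value_zero, slope₀_zero, slope₁_zero, dir, Pi.sub_apply]
      refine Prod.ext (Prod.ext ?_ ?_) (Prod.ext ?_ ?_)
      · simp
        linear_combination t * hδ1 + eval m.u m.A * hx2
      · simp
        linear_combination t * hγ1 + eval n.u n.A * hy2
      · simp
        linear_combination t * hδ2 + eval m.u m.A * hx3
      · simp
        linear_combination t * hγ2 + eval n.u n.A * hy3) hV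
  filter_upwards [nhdsWithin_le_nhds hsol, self_mem_nhdsWithin] with s ⟨z, ⟨⟨h1, h2⟩, h3, h4⟩, h0⟩ hs
  have hs' : 0 < s := hs
  refine ⟨m.pt s z.1, n.pt s z.2, ⟨h1, ?_⟩, ⟨h2, ?_⟩,
    isCandidate_of_system_eq_zero (μ := 1) h0 fun k => ?_⟩
  · rw [pt_sub_mul]; exact mul_pos hs' h3
  · rw [pt_sub_mul]; exact mul_pos hs' h4
  · simp [dir, pt]; ring

theorem exists_linear_solution {A B C D : ℝ} (h : A * D - B * C ≠ 0) (e f : ℝ) :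
    ∃ X Y, A * X + B * Y = e ∧ C * X + D * Y = f := by
  refine ⟨(e * D - B * f) / (A * D - B * C), (A * f - e * C) / (A * D - B * C), ?_, ?_⟩
  · rw [mul_div_assoc', mul_div_assoc', ← add_div, div_eq_iff h]; ring
  · rw [mul_div_assoc', mul_div_assoc', ← add_div, div_eq_iff h]; ring

/-- The coefficients are the dot products of the line directions `(1, a₁)` and `(1, a₂)`, that is,
the metric in the coordinates given by the two forms. -/
theorem vec_cross_slope (n : Node) (x y p : ℝ × ℝ) :
    (n.vec y 0 - n.vec x 0) * n.slope₁ 0 p - (n.vec y 1 - n.vec x 1) * n.slope₀ 0 p =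
      eval n.u n.A / (n.a₂ - n.a₁) *
        (p.1 * ((1 + n.a₂ ^ 2) * (y.1 - x.1) - (1 + n.a₁ * n.a₂) * (y.2 - x.2)) +
          p.2 * ((1 + n.a₁ * n.a₂) * (y.1 - x.1) - (1 + n.a₁ ^ 2) * (y.2 - x.2))) := by
  have : n.a₂ - n.a₁ ≠ 0 := sub_ne_zero.2 n.ne.symm
  rw [slope₀_zero, slope₁_zero]
  simp only [vec, Matrix.cons_val_zero, Matrix.cons_val_one]
  field_simp
  ring

/-- The apices of the two branches at a node are joined by a diameter. -/
theorem eventually_exists_of_node (n : Node) (hn : 0 < 1 + n.a₁ * n.a₂) :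
    ∀ᶠ s in 𝓝[>] (0 : ℝ), ∃ p q, n.Side p ∧ n.OppositeSide q ∧
      IsCandidate (n.poly (s ^ 2)) (n.poly (s ^ 2)) p q := by
  set α := 1 + n.a₂ ^ 2 with hα
  set β := 1 + n.a₁ ^ 2 with hβ
  set γ := 1 + n.a₁ * n.a₂ with hγ
  set Δ := n.a₂ - n.a₁ with hΔdef
  set c := eval n.u n.A with hc
  have hc0 : c ≠ 0 := n.ne_zero
  have hΔ : Δ ≠ 0 := sub_ne_zero.2 n.ne.symm
  have hα0 : 0 < α := by positivity
  have hβ0 : 0 < β := by positivity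
  -- The apex is the point of the branch equidistant from the two lines, which is what `α x² = β y²`
  -- says.
  obtain ⟨x, y, hx0, hy0, hxy, hαβ⟩ : ∃ x y : ℝ, 0 < x ∧ y < 0 ∧ x * y = -1 ∧
      α * x ^ 2 = β * y ^ 2 := by
    have h4 : 0 < √(√(β / α)) := Real.sqrt_pos.2 (Real.sqrt_pos.2 (by positivity))
    set r := √(√(β / α)) with hr
    have hr4 : r ^ 4 = β / α := by
      rw [show r ^ 4 = (r ^ 2) ^ 2 by ring, hr, Real.sq_sqrt (Real.sqrt_nonneg _),
        Real.sq_sqrt (by positivity)]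
    refine ⟨r, -r⁻¹, h4, by simpa using h4, by field_simp, ?_⟩
    field_simp at hr4 ⊢
    linarith
  have hV : ∀ᶠ z : ℝ × ((ℝ × ℝ) × (ℝ × ℝ)) in 𝓝 (0, ((x, y), (-x, -y))),
      (|n.pt z.1 z.2.1 0 - n.u 0| < 1 / 2 ∧ |n.pt z.1 z.2.2 0 - n.u 0| < 1 / 2) ∧
      (0 < z.2.1.1 - z.2.1.2 ∧ z.2.2.1 - z.2.2.2 < 0) := by
    refine ((n.eventually_abs_lt contDiff_fst _).and (n.eventually_abs_lt contDiff_snd _)).and ?_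
    refine Filter.Eventually.and ?_ ?_
    · exact (Continuous.tendsto (f := fun z : ℝ × ((ℝ × ℝ) × (ℝ × ℝ)) => z.2.1.1 - z.2.1.2)
        (by fun_prop) _).eventually_const_lt (by simp only; linarith)
    · exact (Continuous.tendsto (f := fun z : ℝ × ((ℝ × ℝ) × (ℝ × ℝ)) => z.2.2.1 - z.2.2.2)
        (by fun_prop) _).eventually_lt_const (by simp only; linarith)
  -- Both ends tend to the same vertex, so here `dir` is the displacement divided by `s`: `w = 0`
  -- and `κ = (1, 0)`.
  have hsol := eventually_exists_zero (contDiff_system n n 0 (1, 0)) (z₀ := ((x, y), (-x, -y)))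
    (fun τ => by
      obtain ⟨⟨τ₁, τ₂⟩, τ₃, τ₄⟩ := τ
      have hx2 : 0 < α * x ^ 2 := by positivity
      -- By central symmetry the linearized system splits into a system for the difference `(M, N)`
      -- of the two variations, with determinant `α x² + β y²`, and one for their sum `(S, T)`, with
      -- determinant `-2 γ - 2 α x²`. The second is nonzero because `γ > 0`.
      obtain ⟨M, N, hMN1, hMN2⟩ := exists_linear_solution (A := y) (B := x) (C := -α * x)
        (D := β * y) (by nlinarith) (-(τ₁ + τ₂) / c) (Δ * (τ₄ - τ₃) / (4 * c))
      obtain ⟨S, T, hST1, hST2⟩ := exists_linear_solution (A := y) (B := x) (C := α * x - γ * y)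
        (D := γ * x - β * y) (by
          have : y * (γ * x - β * y) - x * (α * x - γ * y) = -2 * γ - 2 * (α * x ^ 2) := by
            linear_combination 2 * γ * hxy + hαβ
          rw [this]
          nlinarith) ((τ₁ - τ₂) / c) (-(Δ * (τ₃ + τ₄)) / (2 * c))
      rw [eq_div_iff hc0] at hMN1 hST1
      rw [eq_div_iff (by positivity)] at hMN2 hST2
      set p := (S - M) / 2 with hp
      set q := (T - N) / 2 with hq
      set p' := (S + M) / 2 with hp'
      set q' := (T + N) / 2 with hq'
      refine ⟨((p, q), (p', q')), ((c * (p * q), c * (p' * q')),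
        (c / Δ * (p * (α * M - γ * N) + q * (γ * M - β * N)),
          c / Δ * (p' * (α * M - γ * N) + q' * (γ * M - β * N)))), fun t => ?_⟩
      have hd : ∀ z k, dir n n 0 (1, 0) (0, z) k = n.vec z.2 k - n.vec z.1 k := by simp [dir]
      simp only [system, value_zero, hd, vec_cross_slope, ← hc, ← hα, ← hβ, ← hγ, ← hΔdef]
      refine Prod.ext (Prod.ext ?_ ?_) (Prod.ext ?_ ?_)
      · simp [hp, hq]
        linear_combination c * hxy + t / 2 * (hST1 - hMN1)
      · simp [hp', hq']
        linear_combination c * hxy - t / 2 * (hST1 + hMN1)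
      · simp [hp, hq, hp', hq']
        field_simp
        linear_combination 2 * t * (-hST2 - hMN2) - 8 * c * hαβ
      · simp [hp, hq, hp', hq']
        field_simp
        linear_combination 2 * t * (-hST2 + hMN2) + 8 * c * hαβ) hV
  filter_upwards [nhdsWithin_le_nhds hsol, self_mem_nhdsWithin] with s ⟨z, ⟨⟨h1, h2⟩, h3, h4⟩, h0⟩ hs
  have hs' : 0 < s := hs
  refine ⟨n.pt s z.1, n.pt s z.2, ⟨h1, ?_⟩, ⟨h2, ?_⟩,
    isCandidate_of_system_eq_zero (μ := s) h0 fun k => ?_⟩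
  · rw [pt_sub_mul]; exact mul_pos hs' h3
  · rw [pt_sub_mul]; exact mul_neg_of_pos_of_neg hs' h4
  · simp [dir, pt]; ring

end Node

/-! ### Branches of a well-spread arrangement and the count of diameters. -/

section arrangement

variable {d : ℕ} {a b : Fin d → ℝ}

theorem eval_vertex_cofactor₂_ne_zero (h : StronglyGeneric a b) {i j : Fin d} (hij : i ≠ j) :
    eval (vertex (a i) (b i) (a j) (b j)) (cofactor₂ a b i j) ≠ 0 := by
  rw [cofactor₂, map_prod]
  refine Finset.prod_ne_zero_iff.2 fun k hk => ?_
  simp only [Finset.mem_compl, Finset.mem_insert, Finset.mem_singleton, not_or] at hk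
  exact h.not_concurrent i j k hij (Ne.symm hk.1) (Ne.symm hk.2) _ (vertex_mem_left _ _ _ _)
    (vertex_mem_right (h.not_parallel i j hij))

theorem eval_smoothing {i j : Fin d} (hij : i ≠ j) {v : Plane}
    (hi : v ∈ zeroLocus (lineForm (a i) (b i))) (hj : v ∈ zeroLocus (lineForm (a j) (b j))) :
    eval v (smoothing a b) = eval v (cofactor₂ a b i j) := by
  obtain ⟨B, C, hBC⟩ := exists_smoothing_eq a b hij
  have hi' : eval v (lineForm (a i) (b i)) = 0 := hi
  have hj' : eval v (lineForm (a j) (b j)) = 0 := hj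
  rw [hBC]
  simp [hi', hj']

/-- Positive slopes make `1 + a i * a j` positive, so the wide cone is where the two forms have the
same sign; near the vertex the cofactor keeps the sign it has there, which is that of `H`. -/
theorem isNarrowPersistingResolution_smoothing (h : StronglyGeneric a b)
    (hpos : ∀ i, 0 < a i) : IsNarrowPersistingResolution a b (smoothing a b) where
  degree_le := by
    rcases smoothing_eq_zero_or a b with h0 | h0
    · simp [h0]
    · omega
  merges i j hij v hi hj := by
    have hA : eval v (cofactor₂ a b i j) ≠ 0 := by
      rw [cofactor₂, map_prod]
      refine Finset.prod_ne_zero_iff.2 fun k hk => ?_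
      simp only [Finset.mem_compl, Finset.mem_insert, Finset.mem_singleton, not_or] at hk
      exact h.not_concurrent i j k hij (Ne.symm hk.1) (Ne.symm hk.2) v hi hj
    have hcont : Continuous fun p : Plane =>
        eval v (cofactor₂ a b i j) * eval p (cofactor₂ a b i j) :=
      continuous_const.mul (contDiff_eval _).continuous
    have hev : ∀ᶠ p in 𝓝 v, 0 < eval v (cofactor₂ a b i j) * eval p (cofactor₂ a b i j) :=
      (hcont.tendsto v).eventually_const_lt (mul_self_pos.2 hA)
    filter_upwards [nhdsWithin_le_nhds hev, self_mem_nhdsWithin] with p hp hpK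
    have hK : 0 < (1 + a i * a j) *
      (eval p (lineForm (a i) (b i)) * eval p (lineForm (a j) (b j))) := hpK
    have h1 : 0 < 1 + a i * a j := by have := mul_pos (hpos i) (hpos j); linarith
    have h2 := (mul_pos_iff_of_pos_left h1).1 hK
    rw [eval_smoothing hij hi hj, arrangement_eq_mul_cofactor₂ a b hij, map_mul, map_mul]
    calc 0 < _ := mul_pos h2 hp
      _ = _ := by ring

/-- The node of the arrangement at the intersection of two of its lines. -/
noncomputable def nodeAt (h : StronglyGeneric a b) (i j : Fin d) (hij : i ≠ j) : Node where
  a₁ := a i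
  a₂ := a j
  u := vertex (a i) (b i) (a j) (b j)
  A := cofactor₂ a b i j
  H := smoothing a b
  ne := h.not_parallel i j hij
  ne_zero := eval_vertex_cofactor₂_ne_zero h hij
  eval_eq := eval_smoothing hij (vertex_mem_left _ _ _ _)
    (vertex_mem_right (h.not_parallel i j hij))

theorem poly_nodeAt (h : StronglyGeneric a b) {i j : Fin d} (hij : i ≠ j) (ε : ℝ) :
    (nodeAt h i j hij).poly ε = arrangement a b + C ε * smoothing a b := by
  have hi := vertex_mem_left (a i) (b i) (a j) (b j)
  have hj := vertex_mem_right (b₁ := b i) (b₂ := b j) (h.not_parallel i j hij)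
  simp only [zeroLocus, Set.mem_ofPred_eq, eval_lineForm] at hi hj
  rw [arrangement_eq_mul_cofactor₂ a b hij, Node.poly]
  simp only [nodeAt]
  rw [sub_eq_zero.1 hi, sub_eq_zero.1 hj]

/-- The vertices are at distance at least one horizontally, and the lines connecting them are not
perpendicular to lines of slopes between those of the arrangement. -/
structure WellSpread (a b : Fin d → ℝ) : Prop where
  sep : ∀ i j k l : Fin d, i ≠ j → k ≠ l →
    |vertex (a i) (b i) (a j) (b j) 0 - vertex (a k) (b k) (a l) (b l) 0| < 1 →
    (i = k ∧ j = l) ∨ (i = l ∧ j = k)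
  dir : ∀ i j k l m n : Fin d, i ≠ j → k ≠ l → ¬ ((i = k ∧ j = l) ∨ (i = l ∧ j = k)) →
    0 < (vertex (a k) (b k) (a l) (b l) 0 - vertex (a i) (b i) (a j) (b j) 0 +
        a m * (vertex (a k) (b k) (a l) (b l) 1 - vertex (a i) (b i) (a j) (b j) 1)) *
      (vertex (a k) (b k) (a l) (b l) 0 - vertex (a i) (b i) (a j) (b j) 0 +
        a n * (vertex (a k) (b k) (a l) (b l) 1 - vertex (a i) (b i) (a j) (b j) 1))

theorem vertex_zero_comm (a₁ b₁ a₂ b₂ : ℝ) : vertex a₁ b₁ a₂ b₂ 0 = vertex a₂ b₂ a₁ b₁ 0 := by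
  simp only [vertex, Matrix.cons_val_zero]
  rw [← neg_div_neg_eq]
  simp

/-- Branches of the resolution at its vertices, as ordered pairs of distinct lines. -/
abbrev Branch (d : ℕ) := {p : Fin d × Fin d // p.1 ≠ p.2}

/-- The half strip that contains a branch near its vertex. -/
def branchRegion (h : StronglyGeneric a b) (β : Branch d) (p : Plane) : Prop :=
  (nodeAt h β.1.1 β.1.2 β.2).Side p

/-- The strips of half-width `1 / 2` around distinct vertices are disjoint, and reversing the pair
of lines selects the opposite half of a strip. -/
theorem branch_unique (h : StronglyGeneric a b) (hw : WellSpread a b) {β γ : Branch d} {p : Plane}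
    (hβ : branchRegion h β p) (hγ : branchRegion h γ p) : β = γ := by
  obtain ⟨⟨i, j⟩, hij⟩ := β
  obtain ⟨⟨k, l⟩, hkl⟩ := γ
  obtain ⟨hβ1, hβ2⟩ := hβ
  obtain ⟨hγ1, hγ2⟩ := hγ
  simp only [nodeAt] at hβ1 hβ2 hγ1 hγ2
  have hlt : |vertex (a i) (b i) (a j) (b j) 0 - vertex (a k) (b k) (a l) (b l) 0| < 1 := by
    rw [abs_lt] at hβ1 hγ1 ⊢
    constructor <;> linarith [hβ1.1, hβ1.2, hγ1.1, hγ1.2]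
  rcases hw.sep i j k l hij hkl hlt with ⟨rfl, rfl⟩ | ⟨rfl, rfl⟩
  · rfl
  · rw [vertex_zero_comm] at hγ2
    exact absurd hγ2 (by linarith)

theorem eventually_exists_candidate (h : StronglyGeneric a b) (hw : WellSpread a b)
    (hpos : ∀ i, 0 < a i) {β γ : Branch d} (hne : β ≠ γ) :
    ∀ᶠ s in 𝓝[>] (0 : ℝ), ∃ p q, branchRegion h β p ∧ branchRegion h γ q ∧
      Node.IsCandidate (arrangement a b + C (s ^ 2) * smoothing a b)
        (arrangement a b + C (s ^ 2) * smoothing a b) p q := by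
  obtain ⟨⟨i, j⟩, hij⟩ := β
  obtain ⟨⟨k, l⟩, hkl⟩ := γ
  by_cases hsame : (i = k ∧ j = l) ∨ (i = l ∧ j = k)
  · rcases hsame with ⟨rfl, rfl⟩ | ⟨rfl, rfl⟩
    · exact absurd rfl hne
    · have h1 : 0 < 1 + a i * a j := by have := mul_pos (hpos i) (hpos j); linarith
      filter_upwards [(nodeAt h i j hij).eventually_exists_of_node h1] with s ⟨p, q, hp, hq, hc⟩
      rw [poly_nodeAt] at hc
      refine ⟨p, q, hp, ?_, hc⟩
      obtain ⟨hq1, hq2⟩ := hq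
      simp only [branchRegion, Node.Side, nodeAt] at hq1 hq2 ⊢
      rw [vertex_zero_comm] at hq1 hq2
      exact ⟨hq1, by linarith⟩
  · filter_upwards [(nodeAt h i j hij).eventually_exists_of_ne (nodeAt h k l hkl)
      (hw.dir i j k l i j hij hkl hsame) (hw.dir i j k l k l hij hkl hsame)]
      with s ⟨p, q, hp, hq, hc⟩
    rw [poly_nodeAt, poly_nodeAt] at hc
    exact ⟨p, q, hp, hq, hc⟩

theorem card_branch (d : ℕ) : (Fintype.card (Branch d) : ℝ) = (d : ℝ) ^ 2 - d := by
  have h1 : Fintype.card (Branch d) = (Finset.univ : Finset (Fin d)).offDiag.card := by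
    rw [Fintype.card_subtype]
    congr 1
    ext p
    simp
  rw [h1, Finset.offDiag_card, Finset.card_univ, Fintype.card_fin, Nat.cast_sub (Nat.le_mul_self d)]
  push_cast
  ring

/-- Diameters whose endpoints lie on given pairs of branches are distinct. -/
theorem choose_card_branch_le_ncard (h : StronglyGeneric a b) (hw : WellSpread a b) {f : Poly}
    (hfin : (diameters f).Finite) (hns : ∀ p ∈ zeroLocus f, IsNonsingularPoint f p)
    (hc : ∀ β γ : Branch d, β ≠ γ → ∃ p q, branchRegion h β p ∧ branchRegion h γ q ∧
      Node.IsCandidate f f p q) :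
    (Fintype.card (Branch d)).choose 2 ≤ (diameters f).ncard := by
  classical
  have key : ∀ z : {z : Sym2 (Branch d) // ¬ z.IsDiag}, ∃ D : diameters f,
      ∃ β γ p q, z.1 = s(β, γ) ∧ D.1 = s(p, q) ∧ branchRegion h β p ∧ branchRegion h γ q := by
    rintro ⟨z, hz⟩
    induction z using Sym2.ind with
    | _ β γ =>
      rw [Sym2.mk_isDiag_iff] at hz
      obtain ⟨p, q, hp, hq, hcand⟩ := hc β γ hz
      have hp' := hns p hcand.left
      have hq' := hns q hcand.right
      refine ⟨⟨s(p, q), p, q, rfl, ?_, hp', hq', perpToTangent_of_cross_eq hp'.2 hcand.perp_left,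
        perpToTangent_of_cross_eq hq'.2 hcand.perp_right⟩, β, γ, p, q, rfl, rfl, hp, hq⟩
      rintro rfl
      exact hz (branch_unique h hw hp hq)
  choose g hg using key
  have hinj : Function.Injective g := by
    intro z z' hzz'
    obtain ⟨β, γ, p, q, hz, hD, hp, hq⟩ := hg z
    obtain ⟨β', γ', p', q', hz', hD', hp', hq'⟩ := hg z'
    refine Subtype.ext ?_
    rw [hz, hz']
    rw [← hzz', hD, Sym2.eq_iff] at hD'
    rcases hD' with ⟨rfl, rfl⟩ | ⟨rfl, rfl⟩
    · rw [branch_unique h hw hp hp', branch_unique h hw hq hq']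
    · rw [branch_unique h hw hp hq', branch_unique h hw hq hp', Sym2.eq_swap]
  have : Finite (diameters f) := hfin
  have hle := Nat.card_le_card_of_injective g hinj
  rw [Nat.card_eq_fintype_card, Sym2.card_subtype_not_diag] at hle
  exact hle

theorem eventually_resolution (h : StronglyGeneric a b) (hw : WellSpread a b)
    (hpos : ∀ i, 0 < a i) :
    ∀ᶠ ε in 𝓝[>] (0 : ℝ),
      (∀ p ∈ zeroLocus (arrangement a b + C ε * smoothing a b),
        IsNonsingularPoint (arrangement a b + C ε * smoothing a b) p) ∧
      1 / 2 * (d : ℝ) ^ 4 - (d : ℝ) ^ 3 + 1 / 2 * (d : ℝ) ≤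
        ((diameters (arrangement a b + C ε * smoothing a b)).ncard : ℝ) := by
  have hsing : ∀ᶠ ε in 𝓝[>] (0 : ℝ), ¬ ∃ p ∈ zeroLocus (arrangement a b + C ε * smoothing a b),
      grad (arrangement a b + C ε * smoothing a b) p = 0 := by
    -- The parameter 0 is removed, as the arrangement itself is singular at its vertices; the
    -- remaining finite set is closed and misses a neighbourhood of 0.
    have hfin := (finite_setOf_singular h).subset (Set.sdiff_subset (t := {0}))
    have h1 := hfin.isClosed.isOpen_compl.mem_nhds (x := (0 : ℝ)) (by simp)
    filter_upwards [nhdsWithin_le_nhds h1, self_mem_nhdsWithin] with ε hε hε0 hcon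
    exact hε ⟨hcon, (show 0 < ε from hε0).ne'⟩
  have hcand : ∀ᶠ s in 𝓝[>] (0 : ℝ), ∀ β γ : Branch d, β ≠ γ →
      ∃ p q, branchRegion h β p ∧ branchRegion h γ q ∧
      Node.IsCandidate (arrangement a b + C (s ^ 2) * smoothing a b)
        (arrangement a b + C (s ^ 2) * smoothing a b) p q := by
    simp only [Filter.eventually_all]
    exact fun β γ hne => eventually_exists_candidate h hw hpos hne
  -- The local analysis uses `s` with `ε = s ^ 2`.
  have hsqrt : Filter.Tendsto Real.sqrt (𝓝[>] 0) (𝓝[>] 0) := by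
    refine tendsto_nhdsWithin_iff.2 ⟨?_, ?_⟩
    · have := Real.continuous_sqrt.tendsto 0
      rw [Real.sqrt_zero] at this
      exact this.mono_left nhdsWithin_le_nhds
    · filter_upwards [self_mem_nhdsWithin] with ε hε
      exact Real.sqrt_pos.2 hε
  filter_upwards [hsing, hsqrt.eventually hcand, self_mem_nhdsWithin] with ε h1 h2 hε
  rw [Real.sq_sqrt (show 0 < ε from hε).le] at h2
  have hns : ∀ p ∈ zeroLocus (arrangement a b + C ε * smoothing a b),
      IsNonsingularPoint (arrangement a b + C ε * smoothing a b) p := fun p hp =>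
    ⟨hp, fun h0 => h1 ⟨p, hp, h0⟩⟩
  refine ⟨hns, ?_⟩
  have hle := choose_card_branch_le_ncard h hw
    (finite_diameters h.injective (smoothing_eq_zero_or a b) ε) hns h2
  have hle' : (((Fintype.card (Branch d)).choose 2 : ℕ) : ℝ) ≤
      ((diameters (arrangement a b + C ε * smoothing a b)).ncard : ℝ) := by exact_mod_cast hle
  rw [Nat.cast_choose_two, card_branch] at hle'
  refine le_trans (le_of_eq ?_) hle'
  ring

end arrangement

/-! ### Tangents to a flat parabola. -/

section oblate

variable (d : ℕ) (t : ℝ)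

/-- The slopes of an oblate arrangement of tangents to a parabola. -/
def slopes (i : Fin d) : ℝ := t * 2 ^ (i : ℕ)

/-- The intercepts of an oblate arrangement of tangents to a parabola. -/
def intercepts (i : Fin d) : ℝ := -(t * 4 ^ (i : ℕ))

variable {d t}

theorem two_pow_injective : Function.Injective fun i : Fin d => (2 : ℝ) ^ (i : ℕ) := fun i j hij =>
  Fin.ext (pow_right_injective₀ (by norm_num : (0 : ℝ) < 2) (by norm_num) hij)

theorem vertex_slopes (ht : t ≠ 0) {i j : Fin d} (hij : i ≠ j) :
    vertex (slopes d t i) (intercepts d t i) (slopes d t j) (intercepts d t j) =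
      ![2 ^ (i : ℕ) + 2 ^ (j : ℕ), t * (2 ^ (i : ℕ) * 2 ^ (j : ℕ))] := by
  have hne : (2 : ℝ) ^ (i : ℕ) - 2 ^ (j : ℕ) ≠ 0 := sub_ne_zero.2 fun h => hij (two_pow_injective h)
  have h4 : ∀ n : ℕ, (4 : ℝ) ^ n = 2 ^ n * 2 ^ n := fun n => by rw [← mul_pow]; norm_num
  have hx : (intercepts d t j - intercepts d t i) / (slopes d t i - slopes d t j) =
      2 ^ (i : ℕ) + 2 ^ (j : ℕ) := by
    simp only [slopes, intercepts, h4]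
    rw [← mul_sub, div_eq_iff (mul_ne_zero ht hne)]
    ring
  rw [vertex, hx]
  congr 2
  simp only [slopes, intercepts, h4]
  ring

theorem stronglyGeneric_slopes (ht : 0 < t) :
    StronglyGeneric (slopes d t) (intercepts d t) where
  not_parallel i j hij h := hij (two_pow_injective (mul_left_cancel₀ ht.ne' h))
  not_perp i j _ := by
    have : 0 < slopes d t i * slopes d t j := by simp only [slopes]; positivity
    linarith
  not_concurrent i j k hij hik hjk p hi hj hk := by
    have h4 : ∀ n : ℕ, (4 : ℝ) ^ n = 2 ^ n * 2 ^ n := fun n => by rw [← mul_pow]; norm_num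
    have hne : ∀ {i j : Fin d}, i ≠ j → (2 : ℝ) ^ (i : ℕ) - 2 ^ (j : ℕ) ≠ 0 :=
      fun hij => sub_ne_zero.2 fun h => hij (two_pow_injective h)
    simp only [zeroLocus, Set.mem_ofPred_eq, eval_lineForm, slopes, intercepts, h4] at hi hj hk
    have h1 : t * (2 ^ (i : ℕ) - 2 ^ (j : ℕ)) * (2 ^ (i : ℕ) - 2 ^ (k : ℕ)) *
        (2 ^ (j : ℕ) - 2 ^ (k : ℕ)) = 0 := by
      linear_combination ((2 : ℝ) ^ (j : ℕ) - 2 ^ (k : ℕ)) * hi -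
        ((2 : ℝ) ^ (i : ℕ) - 2 ^ (k : ℕ)) * hj + ((2 : ℝ) ^ (i : ℕ) - 2 ^ (j : ℕ)) * hk
    exact mul_ne_zero (mul_ne_zero (mul_ne_zero ht.ne' (hne hij)) (hne hik)) (hne hjk) h1

theorem eq_or_eq_of_two_pow_add {i j k l : ℕ} (hij : i ≠ j) (hkl : k ≠ l)
    (h : 2 ^ i + 2 ^ j = 2 ^ k + 2 ^ l) : (i = k ∧ j = l) ∨ (i = l ∧ j = k) := by
  have h1 : ({i, j} : Finset ℕ) = {k, l} := by
    refine Finset.geomSum_injective le_rfl ?_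
    simpa [Finset.sum_pair hij, Finset.sum_pair hkl] using h
  have hi : i ∈ ({k, l} : Finset ℕ) := h1 ▸ by simp
  have hj : j ∈ ({k, l} : Finset ℕ) := h1 ▸ by simp
  simp only [Finset.mem_insert, Finset.mem_singleton] at hi hj
  omega

/-- Abscissae of distinct vertices are distinct integers. Since `w₀` has size at least 1 and a slope
times `w₁` is smaller than 1, both factors in the direction condition have the sign of `w₀`. -/
theorem wellSpread_slopes (ht : 0 < t) (ht' : t * 8 ^ d ≤ 1) :
    WellSpread (slopes d t) (intercepts d t) := by
  have hone : ∀ i j k l : Fin d, i ≠ j → k ≠ l → ¬ ((i = k ∧ j = l) ∨ (i = l ∧ j = k)) →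
      1 ≤ |((2 : ℝ) ^ (i : ℕ) + 2 ^ (j : ℕ)) - (2 ^ (k : ℕ) + 2 ^ (l : ℕ))| := by
    intro i j k l hij hkl hns
    have h1 : ((2 : ℤ) ^ (i : ℕ) + 2 ^ (j : ℕ)) - (2 ^ (k : ℕ) + 2 ^ (l : ℕ)) ≠ 0 := by
      intro h0
      refine hns ?_
      have := eq_or_eq_of_two_pow_add (fun h => hij (Fin.ext h)) (fun h => hkl (Fin.ext h))
        (by exact_mod_cast sub_eq_zero.1 h0)
      simpa only [Fin.ext_iff] using this
    exact_mod_cast Int.one_le_abs h1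
  constructor
  · intro i j k l hij hkl hlt
    by_contra hns
    rw [vertex_slopes ht.ne' hij, vertex_slopes ht.ne' hkl] at hlt
    exact absurd (hone i j k l hij hkl hns) (not_le.2 hlt)
  · intro i j k l m n hij hkl hns
    rw [vertex_slopes ht.ne' hij, vertex_slopes ht.ne' hkl]
    simp only [Matrix.cons_val_zero, Matrix.cons_val_one]
    set w₀ : ℝ := 2 ^ (k : ℕ) + 2 ^ (l : ℕ) - (2 ^ (i : ℕ) + 2 ^ (j : ℕ)) with hw₀
    set w₁ : ℝ := t * (2 ^ (k : ℕ) * 2 ^ (l : ℕ)) - t * (2 ^ (i : ℕ) * 2 ^ (j : ℕ)) with hw₁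
    have h0 : 1 ≤ |w₀| := by
      rw [hw₀, abs_sub_comm]
      exact hone i j k l hij hkl hns
    have hpow : ∀ i : Fin d, (2 : ℝ) ^ (i : ℕ) < 2 ^ d := fun i =>
      pow_lt_pow_right₀ (by norm_num) i.2
    have hprod : ∀ i j : Fin d, 0 < t * ((2 : ℝ) ^ (i : ℕ) * 2 ^ (j : ℕ)) ∧
        t * ((2 : ℝ) ^ (i : ℕ) * 2 ^ (j : ℕ)) ≤ t * (2 ^ d * 2 ^ d) := fun i j => by
      refine ⟨by positivity, ?_⟩
      have h1 := (hpow i).le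
      have h2 := (hpow j).le
      gcongr
    have h1 : |w₁| ≤ t * (2 ^ d * 2 ^ d) := by
      rw [abs_le]
      constructor <;> linarith [hprod i j, hprod k l]
    have ht1 : t ≤ 1 := by
      refine le_trans ?_ ht'
      exact le_mul_of_one_le_right ht.le (one_le_pow₀ (by norm_num))
    -- A slope is below `t * 2 ^ d` and `|w₁|` is at most `t * 4 ^ d`, which is where `8 ^ d`
    -- originates.
    have hsmall : ∀ m : Fin d, |slopes d t m * w₁| < 1 := by
      intro m
      have hs : 0 < slopes d t m := by simp only [slopes]; positivity
      rw [abs_mul, abs_of_pos hs]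
      calc slopes d t m * |w₁| ≤ slopes d t m * (t * (2 ^ d * 2 ^ d)) := by gcongr
        _ < (t * 2 ^ d) * (t * (2 ^ d * 2 ^ d)) := by
          have := hpow m
          simp only [slopes]
          gcongr
        _ = t * (t * 8 ^ d) := by
          rw [show (8 : ℝ) = 2 * 2 * 2 by norm_num, mul_pow, mul_pow]; ring
        _ ≤ 1 * 1 := by gcongr
        _ = 1 := one_mul 1
    have hm := abs_lt.1 (hsmall m)
    have hn := abs_lt.1 (hsmall n)
    rcases le_abs.1 h0 with h | h
    · exact mul_pos (by linarith) (by linarith)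
    · exact mul_pos_of_neg_of_neg (by linarith) (by linarith)

theorem oblateWithin_slopes (ht : 0 < t) {δ : ℝ} (hδ : t * 2 ^ d ≤ δ) :
    OblateWithin δ (slopes d t) := by
  intro i j
  have hpow : ∀ i : Fin d, 0 < t * (2 : ℝ) ^ (i : ℕ) ∧ t * (2 : ℝ) ^ (i : ℕ) < t * 2 ^ d :=
    fun i => ⟨by positivity, by gcongr; exacts [by norm_num, i.2]⟩
  simp only [slopes]
  rw [abs_lt]
  constructor <;> linarith [(hpow i).1, (hpow i).2, (hpow j).1, (hpow j).2]

end oblate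

/-! ### Assembly of the result. -/

theorem exists_oblate_resolution (d : ℕ) {δ : ℝ} (hδ : 0 < δ) :
    ∃ a b : Fin d → ℝ, StronglyGeneric a b ∧ OblateWithin δ a ∧
      ∃ H : Poly, IsNarrowPersistingResolution a b H ∧
        ∀ᶠ ε : ℝ in 𝓝[>] 0, ∃ f : Poly, f = arrangement a b + C ε * H ∧
          IsCircleFreeCurve d f ∧ (∀ p ∈ zeroLocus f, IsNonsingularPoint f p) ∧
          (diameters f).Finite ∧
          1 / 2 * (d : ℝ) ^ 4 - (d : ℝ) ^ 3 + 1 / 2 * (d : ℝ) ≤ ((diameters f).ncard : ℝ) := by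
  obtain ⟨t, ht, ht1, ht2⟩ : ∃ t : ℝ, 0 < t ∧ t * 8 ^ d ≤ 1 ∧ t * 2 ^ d ≤ δ := by
    refine ⟨min (1 / 8 ^ d) (δ / 2 ^ d), by positivity, ?_, ?_⟩
    · rw [← le_div_iff₀ (by positivity)]
      exact min_le_left _ _
    · rw [← le_div_iff₀ (by positivity)]
      exact min_le_right _ _
  have hg := stronglyGeneric_slopes (d := d) ht
  have hpos : ∀ i, 0 < slopes d t i := fun i => by simp only [slopes]; positivity
  refine ⟨slopes d t, intercepts d t, hg, oblateWithin_slopes ht ht2, smoothing _ _,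
    isNarrowPersistingResolution_smoothing hg hpos, ?_⟩
  filter_upwards [eventually_resolution hg (wellSpread_slopes ht ht1) hpos] with ε ⟨h1, h2⟩
  exact ⟨_, rfl, isCircleFreeCurve_resolution hg.injective (smoothing_eq_zero_or _ _) ε, h1,
    finite_diameters hg.injective (smoothing_eq_zero_or _ _) ε, h2⟩

theorem le_RDiam {d : ℕ} {f : Poly} (hf : IsCircleFreeCurve d f) (hfin : (diameters f).Finite)
    {x : ℝ} (hx : x ≤ ((diameters f).ncard : ℝ)) :
    (x : EReal) ≤ ((RDiam d : ENNReal) : EReal) := by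
  have h1 : (((diameters f).ncard : ℕ) : ℕ∞) ≤ RDiam d := by
    rw [hfin.cast_ncard_eq]
    exact le_iSup₂ (f := fun (g : Poly)
      (_ : g ∈ {g : Poly | IsCircleFreeCurve d g ∧ (diameters g).Finite}) => (diameters g).encard)
      f ⟨hf, hfin⟩
  have h2 : (((diameters f).ncard : ℕ) : ENNReal) ≤ (RDiam d : ENNReal) := by
    have := ENat.toENNReal_le.2 h1
    simpa using this
  calc (x : EReal) ≤ (((diameters f).ncard : ℝ) : EReal) := EReal.coe_le_coe_iff.2 hx
    _ = ((((diameters f).ncard : ℕ) : ENNReal) : EReal) := by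
        rw [← ENNReal.ofReal_natCast, EReal.coe_ennreal_ofReal, max_eq_left (Nat.cast_nonneg _)]
    _ ≤ _ := EReal.coe_ennreal_le_coe_ennreal_iff.2 h2

end RealDiam

theorem mainTheorem4 (d : ℕ) (hd : 1 ≤ d) :
    (((1 / 2 * (d : ℝ) ^ 4 - (d : ℝ) ^ 3 + 1 / 2 * (d : ℝ) : ℝ) : EReal) ≤
        ((RealDiam.RDiam d : ENNReal) : EReal)) ∧
    ∀ δ : ℝ, 0 < δ →
      ∃ a b : Fin d → ℝ, RealDiam.StronglyGeneric a b ∧ RealDiam.OblateWithin δ a ∧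
        ∃ H : RealDiam.Poly, RealDiam.IsNarrowPersistingResolution a b H ∧
          ∀ᶠ ε : ℝ in 𝓝[>] 0, ∃ f : RealDiam.Poly,
            f = RealDiam.arrangement a b + MvPolynomial.C ε * H ∧
            RealDiam.IsCircleFreeCurve d f ∧
            (∀ p ∈ RealDiam.zeroLocus f, RealDiam.IsNonsingularPoint f p) ∧
            (RealDiam.diameters f).Finite ∧
            1 / 2 * (d : ℝ) ^ 4 - (d : ℝ) ^ 3 + 1 / 2 * (d : ℝ) ≤
              ((RealDiam.diameters f).ncard : ℝ) := by
  refine ⟨?_, fun δ hδ => RealDiam.exists_oblate_resolution d hδ⟩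
  obtain ⟨a, b, -, -, H, -, h⟩ := RealDiam.exists_oblate_resolution d one_pos
  obtain ⟨ε, f, -, hf, -, hfin, hle⟩ := h.exists
  exact RealDiam.le_RDiam hf hfin hle
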